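/- Let $N\ge 2$ be an integer and let $\rho,\lambda,\theta,m,q$ be real numbers with $m>0$, $q\ge 0$ and $\kappa:=m+q-1>0$. Consider $$\Delta u+(2-N-2\rho)\,\frac{x\cdot\nabla u}{|x|^2}+\frac{\lambda}{|x|^2}\,u=|x|^{\theta}u^q|\nabla u|^m\quad\text{in } B_R(0)\setminus\{0\}\subset\mathbb R^N. \qquad (E)$$ A positive radial solution of (E) is a positive radially symmetric $C^2$ function on $B_R(0)\setminus\{0\}$ satisfying (E) pointwise; we write $u=u(r)$ with $r=|x|$. Put $\Theta=(\theta+2-m)/\kappa$ and $\sigma=-\kappa\Theta/m$. Assume $\Theta<0$ and $\lambda>0$ (so $\sigma>0$). For $\gamma>0$ set $$d_1=\sigma(\sigma-2\rho)+\lambda(1-q),\qquad d_2=(2-m)d_1-2\lambda mq+(3\sigma-2\rho)\sigma,$$ $$a=\frac{\lambda^{1/m}}{\sigma\gamma^{\kappa/m}},\qquad \mathfrak b_1=a^2\,\frac{d_1}{2\lambda m},\qquad \mathfrak b_2=a^3\,\frac{d_1d_2+\lambda^2mq(1-q)}{6\lambda^2m^2},$$ and consider the asymptotic behaviour $$(P_\pm)\qquad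 u(r)=\gamma\pm\frac{\lambda^{1/m}}{\sigma\gamma^{\kappa/m-1}}\,r^\sigma(1+o(1))\quad\text{as } r\to0^+.$$ (I) Let $R>0$ and let $u$ be any positive radial solution of (E) with $\lim_{|x|\to0}u(x)=\gamma\in(0,\infty)$. Then $u$ satisfies either $(P_+)$ or $(P_-)$. Moreover: (a) If $\mathfrak b_1^2+\mathfrak b_2^2\ne0$ and $u$ satisfies $(P_\pm)$, then, with the corresponding sign, $$u(r)=\gamma\left(1\pm a\,r^\sigma+\mathfrak b_1r^{2\sigma}\pm\mathfrak b_2r^{3\sigma}\right)+o(r^{3\sigma})\quad\text{as } r\to0^+.$$ (b) One has $\mathfrak b_1^2+\mathfrak b_2^2=0$ if and only if $d_1=0$ and $q(1-q)=0$. In this case, if $u$ satisfies $(P_-)$, then $u(r)=\gamma(1-a\,r^\sigma)$ for all small $r>0$; if $u$ satisfies $(P_+)$, then either $u(r)=\gamma(1+a\,r^\sigma)$ for all small $r>0$, or there is a constant $C\in\mathbb R\setminus\{0\}$ such that, as $r\to0^+$, $$u(r)=\gamma+\frac{\lambda^{1/m}}{\sigma}r^\sigma+C\,r^{2\sigma+\frac{\lambda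 m}{\sigma}}\exp\left(-\frac{m\gamma\lambda^{1-\frac1m}}{\sigma}r^{-\sigma}\right)(1+o(1))\quad\text{if } q=1,$$ $$u(r)=\gamma+\frac{(\lambda\gamma)^{1/m}}{\sigma}r^\sigma+C\,r^{2\rho+\sigma}\exp\left(-\frac m\sigma(\lambda\gamma)^{\frac{m-1}m}r^{-\sigma}\right)(1+o(1))\quad\text{if } q=0.$$ (II) For every $\gamma\in(0,\infty)$ there exists $R>0$ such that (E) in $B_R(0)\setminus\{0\}$ has a positive radial solution satisfying $(P_-)$ and infinitely many positive radial solutions satisfying $(P_+)$. -/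

import Mathlib

open scoped Asymptotics

namespace HardyGrad

noncomputable section

/-- `κ = m + q - 1`. -/
def kappa (m q : ℝ) : ℝ := m + q - 1

/-- `Θ = (θ + 2 - m) / κ`. -/
def Theta (θ m q : ℝ) : ℝ := (θ + 2 - m) / kappa m q

/-- `σ = - κ Θ / m`. -/
def sigma (θ m q : ℝ) : ℝ := -(kappa m q * Theta θ m q) / m

/-- `d₁ = σ (σ - 2ρ) + λ (1 - q)`. -/
def d1 (ρ lam θ m q : ℝ) : ℝ :=
  sigma θ m q * (sigma θ m q - 2 * ρ) + lam * (1 - q)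

/-- `d₂ = (2 - m) d₁ - 2 λ m q + (3σ - 2ρ) σ`. -/
def d2 (ρ lam θ m q : ℝ) : ℝ :=
  (2 - m) * d1 ρ lam θ m q - 2 * lam * m * q
    + (3 * sigma θ m q - 2 * ρ) * sigma θ m q

/-- The relative second coefficient `λ^(1/m) / (σ γ^(κ/m))` of the profile. -/
def a1 (lam θ m q γ : ℝ) : ℝ :=
  lam ^ (1 / m) / (sigma θ m q * γ ^ (kappa m q / m))

/-- The coefficient `𝔟₁`. -/
def b1 (ρ lam θ m q γ : ℝ) : ℝ :=
  a1 lam θ m q γ ^ 2 * (d1 ρ lam θ m q / (2 * lam * m))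

/-- The coefficient `𝔟₂`. -/
def b2 (ρ lam θ m q γ : ℝ) : ℝ :=
  a1 lam θ m q γ ^ 3 *
    ((d1 ρ lam θ m q * d2 ρ lam θ m q + lam ^ 2 * m * q * (1 - q)) / (6 * lam ^ 2 * m ^ 2))

/-- The punctured ball `B_R(0) \ {0}` in `ℝ^N`. -/
def puncturedBall (N : ℕ) (R : ℝ) : Set (EuclideanSpace ℝ (Fin N)) :=
  Metric.ball 0 R \ {0}

/-- `u` is a positive radial (classical) solution of
`Δu + (2 - N - 2ρ) (x · ∇u) / |x|² + λ u / |x|² = |x|^θ u^q |∇u|^m` in `B_R(0) \ {0}`.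
Only the values of `u` on the punctured ball matter. -/
structure IsPosRadialSolution {N : ℕ} (ρ lam θ m q R : ℝ)
    (u : EuclideanSpace ℝ (Fin N) → ℝ) : Prop where
  contDiffOn : ContDiffOn ℝ 2 u (puncturedBall N R)
  pos : ∀ x ∈ puncturedBall N R, 0 < u x
  radial : ∀ x ∈ puncturedBall N R, ∀ y ∈ puncturedBall N R, ‖x‖ = ‖y‖ → u x = u y
  eqn : ∀ x ∈ puncturedBall N R,
    Laplacian.laplacian u x
        + (2 - (N : ℝ) - 2 * ρ) * (inner ℝ x (gradient u x) / ‖x‖ ^ 2)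
        + lam / ‖x‖ ^ 2 * u x
      = ‖x‖ ^ θ * u x ^ q * ‖gradient u x‖ ^ m

/-- The profile `(P_ε)`, with `ε = 1` for `(P₊)` and `ε = -1` for `(P₋)`:
`u = γ + ε λ^(1/m) / (σ γ^(κ/m - 1)) |x|^σ (1 + o(1))` as `x → 0`.
The coefficient is nonzero, so the error is `o(|x|^σ)`. -/
def HasProfileP {N : ℕ} (lam θ m q γ ε : ℝ) (u : EuclideanSpace ℝ (Fin N) → ℝ) : Prop :=
  (fun x => u x - (γ + ε * (lam ^ (1 / m) / (sigma θ m q * γ ^ (kappa m q / m - 1)))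
      * ‖x‖ ^ sigma θ m q))
    =o[nhdsWithin 0 {0}ᶜ] (fun x => ‖x‖ ^ sigma θ m q)

/-- The expansion up to fourth order,
`u = γ (1 + ε a |x|^σ + 𝔟₁ |x|^(2σ) + ε 𝔟₂ |x|^(3σ)) + o(|x|^(3σ))` as `x → 0`,
where `a = λ^(1/m) / (σ γ^(κ/m))`. -/
def HasFourTermExpansion {N : ℕ} (ρ lam θ m q γ ε : ℝ)
    (u : EuclideanSpace ℝ (Fin N) → ℝ) : Prop :=
  (fun x => u x - γ * (1 + ε * a1 lam θ m q γ * ‖x‖ ^ sigma θ m q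
      + b1 ρ lam θ m q γ * ‖x‖ ^ (2 * sigma θ m q)
      + ε * b2 ρ lam θ m q γ * ‖x‖ ^ (3 * sigma θ m q)))
    =o[nhdsWithin 0 {0}ᶜ] (fun x => ‖x‖ ^ (3 * sigma θ m q))

/-- `u` is exactly `γ (1 + ε λ^(1/m) / (σ γ^(κ/m)) |x|^σ)` for all small `x ≠ 0`. -/
def IsExactTwoTerm {N : ℕ} (lam θ m q γ ε : ℝ) (u : EuclideanSpace ℝ (Fin N) → ℝ) : Prop :=
  ∀ᶠ x in nhdsWithin 0 {0}ᶜ, u x = γ * (1 + ε * a1 lam θ m q γ * ‖x‖ ^ sigma θ m q)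

/-- The exponentially small correction when `q = 1`:
`r^(2σ + λ m / σ) exp (- (m γ λ^(1 - 1/m) / σ) r^(-σ))`. -/
def expCorrOne (lam θ m q γ r : ℝ) : ℝ :=
  r ^ (2 * sigma θ m q + lam * m / sigma θ m q)
    * Real.exp (-(m * γ * lam ^ (1 - 1 / m) / sigma θ m q) * r ^ (-sigma θ m q))

/-- The exponentially small correction when `q = 0`:
`r^(2ρ + σ) exp (- (m / σ) (λ γ)^((m - 1)/m) r^(-σ))`. -/
def expCorrZero (ρ lam θ m q γ r : ℝ) : ℝ :=
  r ^ (2 * ρ + sigma θ m q)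
    * Real.exp (-(m / sigma θ m q * (lam * γ) ^ ((m - 1) / m)) * r ^ (-sigma θ m q))

end

end HardyGrad

open HardyGrad

/-!
The variable `s = r ^ σ` removes both the dimension and the power `θ` from the radial equation:
with `u(r) = v(s)` and `p = σ v'` it becomes the singular first order system
`v' = p / σ`, `σ s² p' = v^q |p|^m - λ v - β s p` with `β = σ - 2ρ` (`equation_iff_reduced`).
In terms of `τ = 1 / s → ∞` this is an asymptotically autonomous scalar equation for `p`, whose
equilibria are the two zeros `±B` of `γ^q |p|^m - λ γ`; `B` is attracting and `-B` repelling.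

*Profiles.* If `v → γ`, then `s p → 0`, and every level of `p` other than `±B` is crossed in one
direction only, so `p` converges; the limit can only be `±B`
(`IsReducedSolution.tendsto_slope`).

*Expansion.* The difference between the solution and the truncated power series solves a singular
linear equation `s² y' = g y + h` with `g → g₀ ≠ 0`, whose solutions tending to `0` are as small
as `h` (`isLittleO_pow_of_sq_mul_deriv`). Two rounds of this estimate give the expansion
(`IsReducedSolution.expansion`), the coefficients being those for which the residual of the
series is `o(s²)`.

*Degenerate case.* If `d₁ = 0` and `q ∈ {0, 1}`, the affine function `γ ± B s / σ` is an exact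
solution, and along any solution the residual `F = σ s² p'` satisfies a scalar equation
`F' = (A / s² + D / s + O(1)) F`. So `F` vanishes near `0` or is asymptotic to a nonzero
multiple of `s ^ D exp (-A / s)`. The latter is incompatible with `F → 0` if `A < 0`, the case of
slope `-B`; if `A > 0`, two integrations yield the exponentially small correction
(`IsReducedSolution.affine_or_exponential`).

*Existence.* In the variable `τ`, the deviation `Z = p - ε B` is a fixed point of a contraction on
bounded continuous functions. At the attracting equilibrium the initial value of the homogeneous
part is free, which gives infinitely many solutions (`exists_reduced_solutions`).
-/

namespace HardyGrad

open Filter Topology Set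

/-! ### Radial functions and the reduced equation -/

/-- Gradient and Laplacian of a function of `w = ‖x‖²`, where `h₁ = h'` near `‖x‖²` and
`h₂ = h''(‖x‖²)`. -/
theorem gradient_laplacian_comp_norm_sq {N : ℕ} {u : EuclideanSpace ℝ (Fin N) → ℝ}
    {h h₁ : ℝ → ℝ} {h₂ : ℝ} {x : EuclideanSpace ℝ (Fin N)}
    (hh : ∀ᶠ w in 𝓝 (‖x‖ ^ 2), HasDerivAt h (h₁ w) w)
    (hh₁ : HasDerivAt h₁ h₂ (‖x‖ ^ 2))
    (hu : u =ᶠ[𝓝 x] fun y => h (‖y‖ ^ 2)) :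
    gradient u x = (2 * h₁ (‖x‖ ^ 2)) • x ∧
      Laplacian.laplacian u x = 4 * ‖x‖ ^ 2 * h₂ + 2 * N * h₁ (‖x‖ ^ 2) := by
  have hcont : Tendsto (fun y : EuclideanSpace ℝ (Fin N) => ‖y‖ ^ 2) (𝓝 x) (𝓝 (‖x‖ ^ 2)) :=
    (continuous_norm.pow 2).tendsto x
  have hsq : ∀ y : EuclideanSpace ℝ (Fin N),
      HasFDerivAt (fun y : EuclideanSpace ℝ (Fin N) => ‖y‖ ^ 2) (2 • innerSL ℝ y) y :=
    fun y => (hasStrictFDerivAt_norm_sq y).hasFDerivAt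
  have hfd : ∀ y, HasDerivAt h (h₁ (‖y‖ ^ 2)) (‖y‖ ^ 2) →
      HasFDerivAt (fun y : EuclideanSpace ℝ (Fin N) => h (‖y‖ ^ 2))
        ((2 * h₁ (‖y‖ ^ 2)) • innerSL ℝ y) y := by
    intro y hy
    refine (hy.comp_hasFDerivAt y (hsq y)).congr_fderiv ?_
    ext z
    simp
    ring
  have hev : fderiv ℝ u =ᶠ[𝓝 x] fun y => (2 * h₁ (‖y‖ ^ 2)) • innerSL ℝ y := by
    filter_upwards [hu.eventuallyEq_nhds, hcont.eventually hh] with y hy hy'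
    exact hy.fderiv_eq.trans (hfd y hy').fderiv
  constructor
  · rw [gradient, hev.self_of_nhds, map_smul]
    congr 1
    exact (InnerProductSpace.toDual ℝ _).symm_apply_apply x
  · rw [InnerProductSpace.laplacian_eq_iteratedFDeriv_orthonormalBasis u
      (EuclideanSpace.basisFun (Fin N) ℝ)]
    have h2 : HasFDerivAt (fun y : EuclideanSpace ℝ (Fin N) =>
        (2 * h₁ (‖y‖ ^ 2)) • innerSL ℝ y) _ x :=
      ((hh₁.comp_hasFDerivAt x (hsq x)).const_mul 2).smul (innerSL ℝ).hasFDerivAt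
    have h3 : ∀ i, iteratedFDeriv ℝ 2 u x
        ![EuclideanSpace.basisFun (Fin N) ℝ i, EuclideanSpace.basisFun (Fin N) ℝ i]
          = 4 * h₂ * (x i) ^ 2 + 2 * h₁ (‖x‖ ^ 2) := by
      intro i
      rw [iteratedFDeriv_two_apply, hev.fderiv_eq, h2.fderiv]
      have h4 : innerSL ℝ (EuclideanSpace.single i (1 : ℝ)) (EuclideanSpace.single i (1 : ℝ))
          = 1 := by
        rw [innerSL_apply_apply, real_inner_self_eq_norm_sq]
        simp
      simp [EuclideanSpace.inner_single_right]
      rw [h4]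
      ring
    simp_rw [h3]
    rw [Finset.sum_add_distrib, ← Finset.mul_sum, EuclideanSpace.real_norm_sq_eq]
    simp
    ring

/-- In the variable `s = ‖x‖ ^ σ`, with `σ m = -(θ + 2 - m)` and `p = σ dv/ds`, the radial
equation loses its dependence on `N` and `θ`. -/
theorem equation_iff_reduced {N : ℕ} {ρ lam θ m q σ : ℝ} (hσ : 0 < σ)
    (hσm : θ + 2 - m = -(m * σ)) {u : EuclideanSpace ℝ (Fin N) → ℝ} {v p : ℝ → ℝ} {p' : ℝ}
    {x : EuclideanSpace ℝ (Fin N)} (hx : x ≠ 0)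
    (hv : ∀ᶠ s in 𝓝 (‖x‖ ^ σ), HasDerivAt v (p s / σ) s)
    (hp : HasDerivAt p p' (‖x‖ ^ σ))
    (hu : ∀ᶠ y in 𝓝 x, u y = v (‖y‖ ^ σ)) :
    Laplacian.laplacian u x
        + (2 - (N : ℝ) - 2 * ρ) * (inner ℝ x (gradient u x) / ‖x‖ ^ 2)
        + lam / ‖x‖ ^ 2 * u x
      = ‖x‖ ^ θ * u x ^ q * ‖gradient u x‖ ^ m ↔
    σ * (‖x‖ ^ σ) ^ 2 * p' + (σ - 2 * ρ) * ‖x‖ ^ σ * p (‖x‖ ^ σ) + lam * v (‖x‖ ^ σ)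
      = v (‖x‖ ^ σ) ^ q * |p (‖x‖ ^ σ)| ^ m := by
  have hr : 0 < ‖x‖ := norm_pos_iff.mpr hx
  have key : ∀ y : EuclideanSpace ℝ (Fin N), (‖y‖ ^ 2) ^ (σ / 2) = ‖y‖ ^ σ := by
    intro y
    rw [← Real.rpow_natCast, ← Real.rpow_mul (norm_nonneg y)]
    congr 1
    push_cast
    ring
  have hpow : ∀ w : ℝ, 0 < w → HasDerivAt (fun w : ℝ => w ^ (σ / 2))
      (σ / 2 * w ^ (σ / 2 - 1)) w := fun w hw => Real.hasDerivAt_rpow_const (Or.inl hw.ne')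
  have hw0 : 0 < ‖x‖ ^ 2 := by positivity
  have hcw : Tendsto (fun w : ℝ => w ^ (σ / 2)) (𝓝 (‖x‖ ^ 2)) (𝓝 (‖x‖ ^ σ)) := by
    rw [← key x]
    exact (hpow _ hw0).continuousAt
  have hh : ∀ᶠ w in 𝓝 (‖x‖ ^ 2), HasDerivAt (fun w => v (w ^ (σ / 2)))
      (p (w ^ (σ / 2)) / 2 * w ^ (σ / 2 - 1)) w := by
    filter_upwards [hcw.eventually hv, lt_mem_nhds hw0] with w hw hw1
    refine (hw.comp w (hpow w hw1)).congr_deriv ?_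
    field_simp
  have hp2 : HasDerivAt p p' ((‖x‖ ^ 2) ^ (σ / 2)) := by rwa [key x]
  have hh₁ : HasDerivAt (fun w => p (w ^ (σ / 2)) / 2 * w ^ (σ / 2 - 1))
      ((p' * (σ / 2 * (‖x‖ ^ 2) ^ (σ / 2 - 1))) / 2 * (‖x‖ ^ 2) ^ (σ / 2 - 1)
        + p ((‖x‖ ^ 2) ^ (σ / 2)) / 2 * ((σ / 2 - 1) * (‖x‖ ^ 2) ^ (σ / 2 - 1 - 1)))
      (‖x‖ ^ 2) :=
    ((hp2.comp (‖x‖ ^ 2) (hpow _ hw0)).div_const 2).mul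
      (Real.hasDerivAt_rpow_const (Or.inl hw0.ne'))
  obtain ⟨hg, hl⟩ := gradient_laplacian_comp_norm_sq hh hh₁
    (hu.mono fun y hy => by simpa only [key y] using hy)
  rw [hl, hg, hu.self_of_nhds, norm_smul, inner_smul_right, real_inner_self_eq_norm_sq,
    Real.rpow_sub_one hw0.ne' (σ / 2 - 1), Real.rpow_sub_one hw0.ne', key x]
  set r := ‖x‖ with hr_def
  set s := r ^ σ with hs
  have hs0 : 0 < s := Real.rpow_pos_of_pos hr σ
  have hsm : s ^ m * r ^ (θ + 2 - m) = 1 := by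
    rw [hs, ← Real.rpow_mul hr.le, ← Real.rpow_add hr, hσm]
    convert Real.rpow_zero r using 2
    ring
  have hrm : r ^ (θ + 2 - m) = r ^ θ * r ^ 2 / r ^ m := by
    rw [Real.rpow_sub hr, Real.rpow_add hr]
    norm_num
  have hnorm : (‖2 * (p s / 2 * (s / r ^ 2))‖ * r) ^ m = |p s| ^ m * s ^ m / r ^ m := by
    have : ‖2 * (p s / 2 * (s / r ^ 2))‖ * r = |p s| * s / r := by
      rw [Real.norm_eq_abs, show 2 * (p s / 2 * (s / r ^ 2)) = p s * (s / r ^ 2) by ring,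
        abs_mul, abs_of_pos (by positivity : 0 < s / r ^ 2)]
      field_simp
    rw [this, Real.div_rpow (by positivity) hr.le, Real.mul_rpow (abs_nonneg _) hs0.le]
  rw [hnorm]
  have hrhs : r ^ θ * v s ^ q * (|p s| ^ m * s ^ m / r ^ m) = v s ^ q * |p s| ^ m / r ^ 2 := by
    have : r ^ θ * s ^ m / r ^ m = 1 / r ^ 2 := by
      rw [eq_div_iff (by positivity), ← hsm, hrm]
      ring
    calc _ = v s ^ q * |p s| ^ m * (r ^ θ * s ^ m / r ^ m) := by ring
      _ = _ := by rw [this]; ring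
  rw [hrhs, eq_div_iff (by positivity)]
  have : (4 * r ^ 2 * (p' * (σ / 2 * (s / r ^ 2)) / 2 * (s / r ^ 2)
        + p s / 2 * ((σ / 2 - 1) * (s / r ^ 2 / r ^ 2))) + 2 * N * (p s / 2 * (s / r ^ 2))
        + (2 - N - 2 * ρ) * (2 * (p s / 2 * (s / r ^ 2)) * r ^ 2 / r ^ 2)
        + lam / r ^ 2 * v s) * r ^ 2
      = σ * s ^ 2 * p' + (σ - 2 * ρ) * s * p s + lam * v s := by
    field_simp
    ring
  rw [this]

/-- The radial equation in the variable `s = r ^ σ`, as a first order system for `v` and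
`p = σ v'` on `(0, S)`; here `β = σ - 2ρ`. -/
structure IsReducedSolution (σ β lam m q S : ℝ) (v p : ℝ → ℝ) : Prop where
  pos : ∀ s ∈ Ioo 0 S, 0 < v s
  deriv_v : ∀ s ∈ Ioo 0 S, HasDerivAt v (p s / σ) s
  deriv_p : ∀ s ∈ Ioo 0 S,
    HasDerivAt p ((v s ^ q * |p s| ^ m - lam * v s - β * s * p s) / (σ * s ^ 2)) s

theorem isOpen_puncturedBall (N : ℕ) (R : ℝ) : IsOpen (puncturedBall N R) :=
  Metric.isOpen_ball.sdiff isClosed_singleton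

theorem mem_puncturedBall {N : ℕ} {R : ℝ} {x : EuclideanSpace ℝ (Fin N)} :
    x ∈ puncturedBall N R ↔ 0 < ‖x‖ ∧ ‖x‖ < R := by
  simp [puncturedBall, and_comm]

theorem rpow_norm_mem_Ioo {N : ℕ} {R σ : ℝ} (hσ : 0 < σ) {x : EuclideanSpace ℝ (Fin N)}
    (hx : x ∈ puncturedBall N R) : ‖x‖ ^ σ ∈ Ioo 0 (R ^ σ) := by
  rw [mem_puncturedBall] at hx
  exact ⟨Real.rpow_pos_of_pos hx.1 σ, Real.rpow_lt_rpow hx.1.le hx.2 hσ⟩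

/-- A positive radial solution is `v (‖x‖ ^ σ)` for a solution `v` of the reduced system. -/
theorem IsPosRadialSolution.exists_reduced {N : ℕ} (hN : 2 ≤ N) {ρ lam θ m q σ R : ℝ}
    (hσ : 0 < σ) (hσm : θ + 2 - m = -(m * σ)) (hR : 0 < R)
    {u : EuclideanSpace ℝ (Fin N) → ℝ} (hu : IsPosRadialSolution ρ lam θ m q R u) :
    ∃ v p : ℝ → ℝ, IsReducedSolution σ (σ - 2 * ρ) lam m q (R ^ σ) v p ∧
      (∀ x ∈ puncturedBall N R, u x = v (‖x‖ ^ σ)) ∧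
      ∀ l, Tendsto u (𝓝[≠] 0) (𝓝 l) → Tendsto v (𝓝[>] 0) (𝓝 l) := by
  set e : EuclideanSpace ℝ (Fin N) := EuclideanSpace.single ⟨0, by omega⟩ 1 with he
  have hnorm_e : ‖e‖ = 1 := by simp [he]
  set g : ℝ → EuclideanSpace ℝ (Fin N) := fun s => s ^ σ⁻¹ • e with hg
  have hgn : ∀ s, 0 < s → ‖g s‖ = s ^ σ⁻¹ := by
    intro s hs
    rw [hg, norm_smul, hnorm_e, mul_one, Real.norm_of_nonneg (Real.rpow_nonneg hs.le _)]
  have hRσ : (R ^ σ) ^ σ⁻¹ = R := Real.rpow_rpow_inv hR.le hσ.ne'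
  have hgm : ∀ s ∈ Ioo 0 (R ^ σ), g s ∈ puncturedBall N R := by
    intro s hs
    rw [mem_puncturedBall, hgn s hs.1]
    refine ⟨Real.rpow_pos_of_pos hs.1 _, ?_⟩
    calc s ^ σ⁻¹ < (R ^ σ) ^ σ⁻¹ := Real.rpow_lt_rpow hs.1.le hs.2 (by positivity)
      _ = R := hRσ
  have hgc : ContDiffOn ℝ 2 g (Ioo 0 (R ^ σ)) := fun s hs =>
    ((contDiffAt_id.rpow_const_of_ne hs.1.ne').smul contDiffAt_const).contDiffWithinAt
  have hvc : ContDiffOn ℝ 2 (u ∘ g) (Ioo 0 (R ^ σ)) := hu.contDiffOn.comp hgc hgm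
  have huv : ∀ x ∈ puncturedBall N R, u x = (u ∘ g) (‖x‖ ^ σ) := by
    intro x hx
    have hs := rpow_norm_mem_Ioo hσ hx
    refine hu.radial x hx _ (hgm _ hs) ?_
    rw [hgn _ hs.1, Real.rpow_rpow_inv (norm_nonneg x) hσ.ne']
  have hd1 : ∀ s ∈ Ioo 0 (R ^ σ), HasDerivAt (u ∘ g) (deriv (u ∘ g) s) s := fun s hs =>
    ((hvc.contDiffAt (isOpen_Ioo.mem_nhds hs)).differentiableAt (by norm_num)).hasDerivAt
  have hd2 : ∀ s ∈ Ioo 0 (R ^ σ), DifferentiableAt ℝ (deriv (u ∘ g)) s := by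
    intro s hs
    have h1 : ContDiffOn ℝ 1 (deriv (u ∘ g)) (Ioo 0 (R ^ σ)) :=
      hvc.deriv_of_isOpen isOpen_Ioo (by norm_num)
    exact (h1.contDiffAt (isOpen_Ioo.mem_nhds hs)).differentiableAt (by norm_num)
  refine ⟨u ∘ g, fun s => σ * deriv (u ∘ g) s, ⟨fun s hs => hu.pos _ (hgm s hs), ?_, ?_⟩,
    huv, ?_⟩
  · intro s hs
    simpa [hσ.ne'] using hd1 s hs
  · intro s hs
    have hx := hgm s hs
    have hxs : ‖g s‖ ^ σ = s := by rw [hgn s hs.1, Real.rpow_inv_rpow hs.1.le hσ.ne']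
    have hp := (hd2 s hs).hasDerivAt.const_mul σ
    have := (equation_iff_reduced (N := N) (ρ := ρ) (lam := lam) (θ := θ) (m := m) (q := q)
      (u := u) (v := u ∘ g) (p := fun s => σ * deriv (u ∘ g) s)
      (p' := σ * deriv (deriv (u ∘ g)) s) (x := g s) hσ hσm
      (norm_pos_iff.mp (mem_puncturedBall.mp hx).1)
      (by
        rw [hxs]
        filter_upwards [isOpen_Ioo.mem_nhds hs] with t ht
        simpa [hσ.ne'] using hd1 t ht)
      (by rwa [hxs])
      (by
        filter_upwards [(isOpen_puncturedBall N R).mem_nhds hx] with y hy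
        exact huv y hy)).mp (hu.eqn _ hx)
    rw [hxs] at this
    refine hp.congr_deriv ?_
    have hs0 := hs.1
    rw [eq_div_iff (by positivity)]
    linarith
  · intro l hl
    refine hl.comp ?_
    rw [tendsto_nhdsWithin_iff]
    constructor
    · have : Tendsto g (𝓝 0) (𝓝 (g 0)) := by
        have h1 : ContinuousAt (fun s : ℝ => s ^ σ⁻¹) 0 :=
          Real.continuousAt_rpow_const _ _ (Or.inr (by positivity))
        exact h1.smul continuousAt_const
      have hg0 : g 0 = 0 := by simp [hg, Real.zero_rpow (inv_ne_zero hσ.ne')]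
      rw [hg0] at this
      exact this.mono_left nhdsWithin_le_nhds
    · filter_upwards [self_mem_nhdsWithin] with s hs
      have : 0 < ‖g s‖ := by rw [hgn s hs]; exact Real.rpow_pos_of_pos hs _
      exact norm_pos_iff.mp this

/-- Conversely, solutions of the reduced system give positive radial solutions. -/
theorem IsReducedSolution.isPosRadialSolution {ρ lam θ m q σ R : ℝ} (N : ℕ)
    (hσ : 0 < σ) (hσm : θ + 2 - m = -(m * σ)) {v p : ℝ → ℝ}
    (hv : IsReducedSolution σ (σ - 2 * ρ) lam m q (R ^ σ) v p)
    (hp0 : ∀ s ∈ Ioo 0 (R ^ σ), p s ≠ 0) :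
    IsPosRadialSolution ρ lam θ m q R
      (fun x : EuclideanSpace ℝ (Fin N) => v (‖x‖ ^ σ)) := by
  have hvc : ContDiffOn ℝ 2 v (Ioo 0 (R ^ σ)) := by
    have hdv : EqOn (deriv v) (fun s => p s / σ) (Ioo 0 (R ^ σ)) :=
      fun s hs => (hv.deriv_v s hs).deriv
    have hvcont : ContinuousOn v (Ioo 0 (R ^ σ)) :=
      fun s hs => (hv.deriv_v s hs).continuousAt.continuousWithinAt
    have hpcont : ContinuousOn p (Ioo 0 (R ^ σ)) :=
      fun s hs => (hv.deriv_p s hs).continuousAt.continuousWithinAt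
    have hpc : ContDiffOn ℝ 1 p (Ioo 0 (R ^ σ)) := by
      have h01 : (1 : WithTop ℕ∞) = 0 + 1 := by norm_num
      rw [h01, contDiffOn_succ_iff_deriv_of_isOpen isOpen_Ioo]
      refine ⟨fun s hs => (hv.deriv_p s hs).differentiableAt.differentiableWithinAt,
        by simp, ?_⟩
      rw [contDiffOn_zero]
      refine ContinuousOn.congr ?_ (fun s hs => (hv.deriv_p s hs).deriv)
      refine ContinuousOn.div ?_ (by fun_prop) (fun s hs => by have := hs.1; positivity)
      refine ((ContinuousOn.mul ?_ ?_).sub (hvcont.const_smul lam)).sub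
        ((continuousOn_const.mul continuousOn_id).mul hpcont)
      · exact hvcont.rpow_const fun s hs => Or.inl (hv.pos s hs).ne'
      · exact hpcont.abs.rpow_const fun s hs => Or.inl (abs_pos.mpr (hp0 s hs)).ne'
    have h12 : (2 : WithTop ℕ∞) = 1 + 1 := by norm_num
    rw [h12, contDiffOn_succ_iff_deriv_of_isOpen isOpen_Ioo]
    exact ⟨fun s hs => (hv.deriv_v s hs).differentiableAt.differentiableWithinAt, by simp,
      (hpc.div_const σ).congr hdv⟩
  refine ⟨?_, fun x hx => hv.pos _ (rpow_norm_mem_Ioo hσ hx), fun x _ y _ hxy => by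
    simp only [hxy], ?_⟩
  · refine hvc.comp (t := Ioo 0 (R ^ σ)) ?_ (fun x hx => rpow_norm_mem_Ioo hσ hx)
    intro x hx
    have h0 := (mem_puncturedBall.mp hx).1
    exact ((contDiffAt_norm ℝ (norm_pos_iff.mp h0)).rpow_const_of_ne h0.ne').contDiffWithinAt
  · intro x hx
    have hs := rpow_norm_mem_Ioo hσ hx
    refine (equation_iff_reduced hσ hσm (norm_pos_iff.mp (mem_puncturedBall.mp hx).1)
      (by filter_upwards [isOpen_Ioo.mem_nhds hs] with t ht using hv.deriv_v t ht)
      (hv.deriv_p _ hs) (Eventually.of_forall fun y => rfl)).mpr ?_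
    have := hs.1
    field_simp
    ring

/-! ### Differential inequalities near the origin -/

theorem eventually_nhdsGT_zero_iff {P : ℝ → Prop} :
    (∀ᶠ s in 𝓝[>] (0 : ℝ), P s) ↔ ∃ δ > 0, ∀ s ∈ Ioo 0 δ, P s :=
  mem_nhdsGT_iff_exists_Ioo_subset

theorem monotoneOn_Ioo_of_hasDerivAt {f f' : ℝ → ℝ} {a b : ℝ}
    (hf : ∀ s ∈ Ioo a b, HasDerivAt f (f' s) s) (h : ∀ s ∈ Ioo a b, 0 ≤ f' s) :
    MonotoneOn f (Ioo a b) :=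
  monotoneOn_of_hasDerivWithinAt_nonneg (convex_Ioo a b)
    (fun s hs => (hf s hs).continuousAt.continuousWithinAt)
    (fun s hs => (hf s (interior_subset hs)).hasDerivWithinAt)
    (fun s hs => h s (interior_subset hs))

/-- A level that a function can only cross upwards is crossed at most once, so that near `0` the
function stays on one side of it. -/
theorem eventually_ge_or_le_of_deriv_pos {f f' : ℝ → ℝ} {c : ℝ}
    (hf : ∀ᶠ s in 𝓝[>] 0, HasDerivAt f (f' s) s)
    (h : ∀ᶠ s in 𝓝[>] 0, f s = c → 0 < f' s) :
    (∀ᶠ s in 𝓝[>] 0, c ≤ f s) ∨ (∀ᶠ s in 𝓝[>] 0, f s ≤ c) := by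
  obtain ⟨δ, hδ, H⟩ := eventually_nhdsGT_zero_iff.mp (hf.and h)
  by_cases hall : ∀ s ∈ Ioo 0 δ, c ≤ f s
  · exact Or.inl (eventually_nhdsGT_zero_iff.mpr ⟨δ, hδ, hall⟩)
  · push Not at hall
    obtain ⟨s₁, hs₁, hlt⟩ := hall
    refine Or.inr (eventually_nhdsGT_zero_iff.mpr ⟨s₁, hs₁.1, fun s hs => ?_⟩)
    by_contra! hcs
    have hsub : ∀ x ∈ Icc s s₁, x ∈ Ioo 0 δ := fun x hx =>
      ⟨hs.1.trans_le hx.1, hx.2.trans_lt hs₁.2⟩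
    have := image_le_of_deriv_right_lt_deriv_boundary' (f := fun _ => c) (f' := fun _ => 0)
      (a := s) (b := s₁) continuousOn_const (fun x _ => hasDerivWithinAt_const _ _ _)
      (B := f) (B' := f') hcs.le
      (fun x hx => (H x (hsub x hx)).1.continuousAt.continuousWithinAt)
      (fun x hx => (H x (hsub x ⟨hx.1, hx.2.le⟩)).1.hasDerivWithinAt)
      (fun x hx hcx => (H x (hsub x ⟨hx.1, hx.2.le⟩)).2 hcx.symm) ⟨hs.2.le, le_rfl⟩
    linarith

theorem eventually_ge_or_le_of_deriv_neg {f f' : ℝ → ℝ} {c : ℝ}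
    (hf : ∀ᶠ s in 𝓝[>] 0, HasDerivAt f (f' s) s)
    (h : ∀ᶠ s in 𝓝[>] 0, f s = c → f' s < 0) :
    (∀ᶠ s in 𝓝[>] 0, c ≤ f s) ∨ (∀ᶠ s in 𝓝[>] 0, f s ≤ c) := by
  have := eventually_ge_or_le_of_deriv_pos (f := fun s => -f s) (f' := fun s => -f' s) (c := -c)
    (hf.mono fun s hs => hs.neg)
    (h.mono fun s hs hc => by have := hs (neg_inj.mp hc); linarith)
  simp only [neg_le_neg_iff] at this
  exact this.symm

/-- If `s² f' ≥ c > 0` near `0`, then `f` blows up at least like `-c / s`. -/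
theorem eventually_mul_le_of_le_sq_mul_deriv {f f' : ℝ → ℝ} {c : ℝ} (hc : 0 < c)
    (hf : ∀ᶠ s in 𝓝[>] 0, HasDerivAt f (f' s) s)
    (h : ∀ᶠ s in 𝓝[>] 0, c ≤ s ^ 2 * f' s) :
    ∀ᶠ s in 𝓝[>] 0, s * f s ≤ -(c / 2) := by
  obtain ⟨δ, hδ, H⟩ := eventually_nhdsGT_zero_iff.mp (hf.and h)
  have hmono : MonotoneOn (fun s => f s + c * s⁻¹) (Ioo 0 δ) := by
    refine monotoneOn_Ioo_of_hasDerivAt (f' := fun s => f' s + c * (-(s ^ 2)⁻¹)) ?_ ?_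
    · intro s hs
      exact (H s hs).1.add ((hasDerivAt_inv hs.1.ne').const_mul c)
    · intro s hs
      have hs0 := hs.1
      have := (H s hs).2
      have h2 : f' s + c * (-(s ^ 2)⁻¹) = (s ^ 2 * f' s - c) / s ^ 2 := by
        field_simp
        ring
      rw [h2]
      exact div_nonneg (by linarith) (by positivity)
  have hmem : δ / 2 ∈ Ioo 0 δ := ⟨by linarith, by linarith⟩
  set K := f (δ / 2) + c * (δ / 2)⁻¹ with hK
  have h1 : ∀ᶠ s in 𝓝[>] (0 : ℝ), K * s < c / 2 := by
    have : Tendsto (fun s : ℝ => K * s) (𝓝[>] 0) (𝓝 (K * 0)) :=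
      (tendsto_id.const_mul K).mono_left nhdsWithin_le_nhds
    rw [mul_zero] at this
    exact this.eventually (gt_mem_nhds (by linarith))
  have h2 : ∀ᶠ s in 𝓝[>] (0 : ℝ), s ∈ Ioo 0 (δ / 2) := Ioo_mem_nhdsGT (by linarith)
  filter_upwards [h1, h2] with s hs1 hs2
  have h3 : f s + c * s⁻¹ ≤ K := hmono ⟨hs2.1, by linarith [hs2.2]⟩ hmem hs2.2.le
  have h4 : s * (f s + c * s⁻¹) ≤ s * K := mul_le_mul_of_nonneg_left h3 hs2.1.le
  have h5 : s * (f s + c * s⁻¹) = s * f s + c := by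
    have := hs2.1.ne'
    field_simp
  linarith

theorem eventually_le_mul_of_sq_mul_deriv_le {f f' : ℝ → ℝ} {c : ℝ} (hc : 0 < c)
    (hf : ∀ᶠ s in 𝓝[>] 0, HasDerivAt f (f' s) s)
    (h : ∀ᶠ s in 𝓝[>] 0, s ^ 2 * f' s ≤ -c) :
    ∀ᶠ s in 𝓝[>] 0, c / 2 ≤ s * f s := by
  have := eventually_mul_le_of_le_sq_mul_deriv (f := fun s => -f s) (f' := fun s => -f' s) hc
    (hf.mono fun s hs => hs.neg) (h.mono fun s hs => by linarith)
  exact this.mono fun s hs => by linarith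

/-- A function with a limit at `0` cannot have derivative at least `c / s`. -/
theorem not_eventually_le_mul_deriv {f f' : ℝ → ℝ} {c l : ℝ} (hc : 0 < c)
    (hf : ∀ᶠ s in 𝓝[>] 0, HasDerivAt f (f' s) s) (hl : Tendsto f (𝓝[>] 0) (𝓝 l)) :
    ¬ ∀ᶠ s in 𝓝[>] 0, c ≤ s * f' s := by
  intro h
  obtain ⟨δ, hδ, H⟩ := eventually_nhdsGT_zero_iff.mp (hf.and h)
  have hmono : MonotoneOn (fun s => f s - c * Real.log s) (Ioo 0 δ) := by
    refine monotoneOn_Ioo_of_hasDerivAt (f' := fun s => f' s - c * s⁻¹) ?_ ?_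
    · intro s hs
      exact (H s hs).1.sub ((Real.hasDerivAt_log hs.1.ne').const_mul c)
    · intro s hs
      have hs0 := hs.1
      have := (H s hs).2
      have h2 : f' s - c * s⁻¹ = (s * f' s - c) / s := by
        field_simp
      rw [h2]
      exact div_nonneg (by linarith) hs0.le
  have hmem : δ / 2 ∈ Ioo 0 δ := ⟨by linarith, by linarith⟩
  have hbot : Tendsto f (𝓝[>] 0) atBot := by
    have h1 : Tendsto (fun s => (f (δ / 2) - c * Real.log (δ / 2)) + c * Real.log s) (𝓝[>] 0)
        atBot :=
      tendsto_atBot_add_const_left _ _ (Real.tendsto_log_nhdsGT_zero.const_mul_atBot hc)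
    refine tendsto_atBot_mono' _ ?_ h1
    filter_upwards [Ioo_mem_nhdsGT (show (0 : ℝ) < δ / 2 by linarith)] with s hs
    have := hmono ⟨hs.1, by linarith [hs.2]⟩ hmem hs.2.le
    simp only at this
    linarith
  exact not_tendsto_nhds_of_tendsto_atBot hbot l hl

/-- Integration of `o(s ^ k)`. -/
theorem isLittleO_pow_succ_of_deriv {f f' : ℝ → ℝ} {k : ℕ}
    (hf : ∀ᶠ s in 𝓝[>] 0, HasDerivAt f (f' s) s) (hl : Tendsto f (𝓝[>] 0) (𝓝 0))
    (h : f' =o[𝓝[>] 0] fun s => s ^ k) : f =o[𝓝[>] 0] fun s => s ^ (k + 1) := by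
  rw [Asymptotics.isLittleO_iff] at h ⊢
  intro c hc
  obtain ⟨δ, hδ, H⟩ := eventually_nhdsGT_zero_iff.mp (hf.and (h hc))
  filter_upwards [Ioo_mem_nhdsGT hδ] with s hs
  have hs0 := hs.1
  have h1 : ∀ᶠ t in 𝓝[>] (0 : ℝ), ‖f s - f t‖ ≤ c * s ^ (k + 1) := by
    filter_upwards [Ioo_mem_nhdsGT hs0] with t ht
    have hsub : ∀ x ∈ Icc t s, x ∈ Ioo 0 δ := fun x hx =>
      ⟨ht.1.trans_le hx.1, hx.2.trans_lt hs.2⟩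
    have := (convex_Icc t s).norm_image_sub_le_of_norm_hasDerivWithin_le (f := f) (f' := f')
      (C := c * s ^ k) (fun x hx => (H x (hsub x hx)).1.hasDerivWithinAt)
      (fun x hx => by
        have hx0 := (hsub x hx).1
        refine (H x (hsub x hx)).2.trans ?_
        rw [Real.norm_of_nonneg (by positivity)]
        gcongr
        exact hx.2)
      (left_mem_Icc.mpr ht.2.le) (right_mem_Icc.mpr ht.2.le)
    refine this.trans ?_
    rw [Real.norm_of_nonneg (by linarith [ht.2]), pow_succ, ← mul_assoc]
    gcongr
    linarith [ht.1]
  have h2 : Tendsto (fun t => ‖f s - f t‖) (𝓝[>] 0) (𝓝 ‖f s - 0‖) :=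
    (tendsto_const_nhds.sub hl).norm
  rw [sub_zero] at h2
  rw [Real.norm_of_nonneg (by positivity : (0:ℝ) ≤ s ^ (k + 1))]
  exact le_of_tendsto h2 h1

/-- One-sided bound behind `isLittleO_pow_of_sq_mul_deriv`. -/
theorem eventually_le_mul_pow_of_sq_mul_deriv {y y' : ℝ → ℝ} {g : ℝ} {k : ℕ} (hg : g ≠ 0)
    (hy : ∀ᶠ s in 𝓝[>] 0, HasDerivAt y (y' s) s) (hl : Tendsto y (𝓝[>] 0) (𝓝 0))
    (h : (fun s => s ^ 2 * y' s - g * y s) =o[𝓝[>] 0] fun s => |y s| + s ^ k)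
    {c : ℝ} (hc : 0 < c) : ∀ᶠ s in 𝓝[>] 0, y s ≤ c * s ^ k := by
  have hg0 : 0 < |g| := abs_pos.mpr hg
  have hpos : ∀ᶠ s in 𝓝[>] (0 : ℝ), 0 < s := self_mem_nhdsWithin
  -- on `y ≥ c s ^ k` the error is at most `|g| / 4` times `y`
  have herr : ∀ᶠ s in 𝓝[>] 0, c * s ^ k ≤ y s → |s ^ 2 * y' s - g * y s| ≤ |g| / 4 * y s := by
    have hε : 0 < |g| / 4 / (1 + c⁻¹) := by positivity
    filter_upwards [Asymptotics.isLittleO_iff.mp h hε, hpos] with s hs hs0 hcy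
    have hy0 : 0 < y s := lt_of_lt_of_le (by positivity) hcy
    have h1 : s ^ k ≤ c⁻¹ * y s := by
      rw [← div_eq_inv_mul, le_div_iff₀ hc]
      linarith
    rw [Real.norm_eq_abs, Real.norm_of_nonneg (by positivity), abs_of_pos hy0] at hs
    refine hs.trans ?_
    rw [div_mul_eq_mul_div, div_le_iff₀ (by positivity)]
    have : |g| / 4 * (y s + s ^ k) ≤ |g| / 4 * (y s + c⁻¹ * y s) := by gcongr
    linarith
  rcases lt_or_gt_of_ne hg with hneg | hposg
  · -- here `y ≥ c s ^ k` cannot persist: `y` would increase as `s` decreases, instead of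
    -- tending to `0`
    have hz : (∀ᶠ s in 𝓝[>] 0, c * s ^ k ≤ y s) ∨ (∀ᶠ s in 𝓝[>] 0, y s ≤ c * s ^ k) := by
      have := eventually_ge_or_le_of_deriv_neg (f := fun s => y s - c * s ^ k)
        (f' := fun s => y' s - c * (k * s ^ (k - 1))) (c := 0)
        (by
          filter_upwards [hy] with s hs
          exact hs.sub ((hasDerivAt_pow k s).const_mul c))
        (by
          filter_upwards [herr, hpos] with s hs hs0 heq
          have hyc : y s = c * s ^ k := by linarith
          have hy0 : 0 < y s := by rw [hyc]; positivity
          have h1 := abs_le.mp (hs hyc.ge)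
          rw [abs_of_neg hneg] at h1
          have h2 : s ^ 2 * y' s < 0 := by nlinarith [h1.2]
          have h3 : y' s < 0 := by
            by_contra! h4
            have := mul_nonneg (sq_nonneg s) h4
            linarith
          have h5 : 0 ≤ c * (k * s ^ (k - 1)) := by positivity
          linarith)
      simpa only [sub_nonneg, sub_nonpos] using this
    rcases hz with hz | hz
    · exfalso
      obtain ⟨δ', hδ', H'⟩ := eventually_nhdsGT_zero_iff.mp (hz.and (hy.and (herr.and hpos)))
      have hmono : MonotoneOn (fun s => -y s) (Ioo 0 δ') := by
        refine monotoneOn_Ioo_of_hasDerivAt (f' := fun s => -y' s)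
          (fun s hs => (H' s hs).2.1.neg) ?_
        intro s hs
        obtain ⟨h1, h2, h3, h4⟩ := H' s hs
        have hy0 : 0 < y s := lt_of_lt_of_le (by positivity) h1
        have h5 := abs_le.mp (h3 h1)
        rw [abs_of_neg hneg] at h5
        have h6 : s ^ 2 * y' s < 0 := by nlinarith [h5.2]
        by_contra! h7
        have := mul_nonneg (sq_nonneg s) (show 0 ≤ y' s by linarith)
        linarith
      have hm : δ' / 2 ∈ Ioo 0 δ' := ⟨by linarith, by linarith⟩
      have hyd : 0 < y (δ' / 2) :=
        lt_of_lt_of_le (by positivity) (H' _ hm).1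
      have : y (δ' / 2) ≤ 0 := by
        refine ge_of_tendsto hl ?_
        filter_upwards [Ioo_mem_nhdsGT hm.1] with s hs
        have := hmono ⟨hs.1, hs.2.trans hm.2⟩ hm hs.2.le
        simp only at this
        linarith
      linarith
    · exact hz
  · -- here `y / s ^ k` decays like `exp (-g / s)` towards `0` as long as it exceeds `c`
    have hk : ∀ᶠ s in 𝓝[>] (0 : ℝ), k * s < g / 4 := by
      have : Tendsto (fun s : ℝ => k * s) (𝓝[>] 0) (𝓝 (k * 0)) :=
        (tendsto_id.const_mul (k : ℝ)).mono_left nhdsWithin_le_nhds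
      rw [mul_zero] at this
      exact this.eventually (gt_mem_nhds (by linarith))
    set z : ℝ → ℝ := fun s => y s / s ^ k with hz_def
    set z' : ℝ → ℝ := fun s => (y' s * s ^ k - y s * (k * s ^ (k - 1))) / (s ^ k) ^ 2 with hz'
    have hzd : ∀ᶠ s in 𝓝[>] 0, HasDerivAt z (z' s) s := by
      filter_upwards [hy, hpos] with s hs hs0
      exact hs.div (hasDerivAt_pow k s) (by positivity)
    have hzb : ∀ᶠ s in 𝓝[>] 0, c ≤ z s → g / 2 * z s ≤ s ^ 2 * z' s := by
      filter_upwards [herr, hpos, hk] with s hs hs0 hks hcz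
      have hcy : c * s ^ k ≤ y s := by
        rwa [hz_def, le_div_iff₀ (by positivity)] at hcz
      have hy0 : 0 < y s := lt_of_lt_of_le (by positivity) hcy
      have h1 := (abs_le.mp (hs hcy)).1
      rw [abs_of_pos hposg] at h1
      have h2 : s ^ 2 * z' s = (s ^ 2 * y' s - k * s * y s) / s ^ k := by
        rw [hz']
        rcases Nat.eq_zero_or_pos k with rfl | hk0
        · simp
        · have : s ^ k = s ^ (k - 1) * s := by
            rw [← pow_succ, Nat.sub_add_cancel hk0]
          field_simp
          rw [this]
          ring
      rw [h2, hz_def, ← mul_div_assoc]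
      gcongr
      nlinarith
    have hdich := eventually_ge_or_le_of_deriv_pos hzd (c := c) (by
      filter_upwards [hzb, hpos] with s hs hs0 hcz
      have h1 := hs hcz.ge
      rw [hcz] at h1
      have h2 : 0 < s ^ 2 * z' s := lt_of_lt_of_le (by positivity) h1
      exact pos_of_mul_pos_right h2 (by positivity))
    rcases hdich with hge | hle
    · exfalso
      have h1 := eventually_mul_le_of_le_sq_mul_deriv (c := g / 2 * c) (by positivity) hzd (by
        filter_upwards [hge, hzb] with s hs hs2
        refine le_trans ?_ (hs2 hs)
        gcongr)
      obtain ⟨s, hs1, hs2, hs3⟩ := (h1.and (hge.and hpos)).exists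
      have : 0 < s * z s := mul_pos hs3 (by linarith)
      have : 0 < g / 2 * c := by positivity
      linarith
    · filter_upwards [hle, hpos] with s hs hs0
      rwa [hz_def, div_le_iff₀ (by positivity)] at hs

/-- The singular linear equation `s² y' = g y + h` with `g ≠ 0`: a solution tending to `0` is
`o(s ^ k)` as soon as `h` is, up to terms that are small compared to `y`. -/
theorem isLittleO_pow_of_sq_mul_deriv {y y' : ℝ → ℝ} {g : ℝ} {k : ℕ} (hg : g ≠ 0)
    (hy : ∀ᶠ s in 𝓝[>] 0, HasDerivAt y (y' s) s) (hl : Tendsto y (𝓝[>] 0) (𝓝 0))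
    (h : (fun s => s ^ 2 * y' s - g * y s) =o[𝓝[>] 0] fun s => |y s| + s ^ k) :
    y =o[𝓝[>] 0] fun s => s ^ k := by
  rw [Asymptotics.isLittleO_iff]
  intro c hc
  have h1 := eventually_le_mul_pow_of_sq_mul_deriv hg hy hl h hc
  have h2 := eventually_le_mul_pow_of_sq_mul_deriv (y := fun s => -y s) (y' := fun s => -y' s)
    hg (hy.mono fun s hs => hs.neg) (by simpa using hl.neg)
    (by
      simp only [abs_neg]
      refine h.neg_left.congr_left fun s => ?_
      ring) hc
  filter_upwards [h1, h2, self_mem_nhdsWithin] with s hs1 hs2 hs0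
  have hs0' : (0 : ℝ) < s := hs0
  rw [Real.norm_of_nonneg (by positivity : (0:ℝ) ≤ s ^ k), Real.norm_eq_abs]
  exact abs_le.mpr ⟨by linarith, hs1⟩

/-! ### Convergence of the slope -/

theorem IsReducedSolution.eventually {σ β lam m q S : ℝ} {v p : ℝ → ℝ}
    (h : IsReducedSolution σ β lam m q S v p) (hS : 0 < S) :
    ∀ᶠ s in 𝓝[>] 0, 0 < s ∧ 0 < v s ∧ HasDerivAt v (p s / σ) s ∧
      HasDerivAt p ((v s ^ q * |p s| ^ m - lam * v s - β * s * p s) / (σ * s ^ 2)) s := by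
  filter_upwards [Ioo_mem_nhdsGT hS] with s hs
  exact ⟨hs.1, h.pos s hs, h.deriv_v s hs, h.deriv_p s hs⟩

/-- `s p → 0`, that is, `r u'(r) → 0`. On the level `|s p| = δ` the nonlinear term dominates, so
that the level is only crossed upwards, and `s p` cannot stay beyond it since `v` converges. -/
theorem IsReducedSolution.tendsto_mul_slope {σ β lam m q S γ : ℝ} {v p : ℝ → ℝ}
    (h : IsReducedSolution σ β lam m q S v p) (hS : 0 < S) (hσ : 0 < σ) (hm : 0 < m)
    (hγ : 0 < γ) (hl : Tendsto v (𝓝[>] 0) (𝓝 γ)) :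
    Tendsto (fun s => s * p s) (𝓝[>] 0) (𝓝 0) := by
  have hev := h.eventually hS
  have hlevel : ∀ c : ℝ, c ≠ 0 →
      (∀ᶠ s in 𝓝[>] 0, c ≤ s * p s) ∨ (∀ᶠ s in 𝓝[>] 0, s * p s ≤ c) := by
    intro c hc
    have htop : Tendsto (fun s => v s ^ q * (|c| / s) ^ m) (𝓝[>] 0) atTop := by
      have h1 : Tendsto (fun s : ℝ => |c| / s) (𝓝[>] 0) atTop := by
        simpa only [div_eq_mul_inv] using
          tendsto_inv_nhdsGT_zero.const_mul_atTop (abs_pos.mpr hc)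
      exact Tendsto.pos_mul_atTop (Real.rpow_pos_of_pos hγ q)
        (hl.rpow_const (Or.inl hγ.ne')) ((tendsto_rpow_atTop hm).comp h1)
    have hsum : Tendsto (fun s => v s ^ q * (|c| / s) ^ m + (-(lam * v s) + (σ - β) * c))
        (𝓝[>] 0) atTop :=
      htop.atTop_add ((hl.const_mul lam).neg.add_const _)
    refine eventually_ge_or_le_of_deriv_pos (f' := fun s => 1 * p s + s *
      ((v s ^ q * |p s| ^ m - lam * v s - β * s * p s) / (σ * s ^ 2))) ?_ ?_
    · filter_upwards [hev] with s hs
      exact (hasDerivAt_id s).mul hs.2.2.2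
    · filter_upwards [hev, hsum.eventually_gt_atTop 0] with s hs hs2 hsc
      have hs0 := hs.1
      have hp : p s = c / s := by rw [eq_div_iff hs0.ne']; linarith
      have hpa : |p s| = |c| / s := by rw [hp, abs_div, abs_of_pos hs0]
      rw [← hpa] at hs2
      have : 1 * p s + s * ((v s ^ q * |p s| ^ m - lam * v s - β * s * p s) / (σ * s ^ 2))
          = (v s ^ q * |p s| ^ m + (-(lam * v s) + (σ - β) * (s * p s))) / (σ * s) := by
        field_simp
        ring
      rw [this, hsc]
      positivity
  rw [Metric.tendsto_nhds]
  intro δ hδ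
  have h1 : ∀ᶠ s in 𝓝[>] 0, s * p s ≤ δ / 2 := by
    rcases hlevel (δ / 2) (by positivity) with h1 | h1
    · exfalso
      refine not_eventually_le_mul_deriv (c := δ / 2 / σ) (by positivity)
        (hev.mono fun s hs => hs.2.2.1) hl ?_
      filter_upwards [h1] with s hs
      rw [← mul_div_assoc]
      gcongr
    · exact h1
  have h2 : ∀ᶠ s in 𝓝[>] 0, -(δ / 2) ≤ s * p s := by
    rcases hlevel (-(δ / 2)) (by linarith) with h2 | h2
    · exact h2
    · exfalso
      refine not_eventually_le_mul_deriv (f := fun s => -v s) (f' := fun s => -(p s / σ))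
        (c := δ / 2 / σ) (by positivity)
        (hev.mono fun s hs => hs.2.2.1.neg) hl.neg ?_
      filter_upwards [h2] with s hs
      have : s * -(p s / σ) = -(s * p s) / σ := by ring
      rw [this]
      gcongr
      linarith
  filter_upwards [h1, h2] with s hs1 hs2
  rw [Real.dist_eq, sub_zero]
  exact (abs_le.mpr ⟨hs2, hs1⟩).trans_lt (by linarith)

/-- The slope `p = σ v'` converges to one of the two zeros `±B` of `γ^q |p|^m - λ γ`: all other
levels are crossed in one direction only, and away from `±B` the equation would force `s p` to
stay away from `0`. -/
theorem IsReducedSolution.tendsto_slope {σ β lam m q S γ B : ℝ} {v p : ℝ → ℝ}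
    (h : IsReducedSolution σ β lam m q S v p) (hS : 0 < S) (hσ : 0 < σ) (hm : 0 < m)
    (hγ : 0 < γ) (hB : 0 < B) (hBm : γ ^ q * B ^ m = lam * γ)
    (hl : Tendsto v (𝓝[>] 0) (𝓝 γ)) :
    Tendsto p (𝓝[>] 0) (𝓝 B) ∨ Tendsto p (𝓝[>] 0) (𝓝 (-B)) := by
  have hev := h.eventually hS
  have hw := h.tendsto_mul_slope hS hσ hm hγ hl
  have hγq : 0 < γ ^ q := Real.rpow_pos_of_pos hγ q
  set F : ℝ → ℝ → ℝ := fun b s => v s ^ q * b ^ m - lam * v s - β * (s * p s) with hF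
  have hFl : ∀ b, Tendsto (F b) (𝓝[>] 0) (𝓝 (γ ^ q * b ^ m - lam * γ - β * 0)) := fun b =>
    (((hl.rpow_const (Or.inl hγ.ne')).mul_const _).sub (hl.const_mul lam)).sub (hw.const_mul β)
  have hpd : ∀ᶠ s in 𝓝[>] 0, HasDerivAt p (F |p s| s / (σ * s ^ 2)) s := by
    filter_upwards [hev] with s hs
    refine hs.2.2.2.congr_deriv ?_
    rw [hF]
    ring
  have hsq : ∀ᶠ s in 𝓝[>] 0, s ^ 2 * (F |p s| s / (σ * s ^ 2)) = F |p s| s / σ := by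
    filter_upwards [hev] with s hs
    have := hs.1
    field_simp
  have hlim : ∀ b, γ ^ q * b ^ m - lam * γ - β * 0 = γ ^ q * (b ^ m - B ^ m) := by
    intro b
    rw [mul_zero, sub_zero, ← hBm]
    ring
  have hbig : ∀ b, B < b → ∃ c > 0, ∀ᶠ s in 𝓝[>] 0, c < F b s := by
    intro b hb
    have h1 : 0 < γ ^ q * (b ^ m - B ^ m) :=
      mul_pos hγq (sub_pos.mpr (Real.rpow_lt_rpow hB.le hb hm))
    refine ⟨γ ^ q * (b ^ m - B ^ m) / 2, by linarith, (hFl b).eventually (lt_mem_nhds ?_)⟩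
    rw [hlim b]
    linarith
  have hsmall : ∀ b, 0 ≤ b → b < B → ∃ c > 0, ∀ᶠ s in 𝓝[>] 0, F b s < -c := by
    intro b hb0 hb
    have h1 : 0 < γ ^ q * (B ^ m - b ^ m) :=
      mul_pos hγq (sub_pos.mpr (Real.rpow_lt_rpow hb0 hb hm))
    refine ⟨γ ^ q * (B ^ m - b ^ m) / 2, by linarith, (hFl b).eventually (gt_mem_nhds ?_)⟩
    rw [hlim b]
    linarith
  have hFmono : ∀ᶠ s in 𝓝[>] 0, ∀ a b, 0 ≤ a → a ≤ b → F a s ≤ F b s := by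
    filter_upwards [hev] with s hs a b ha hab
    have h1 := Real.rpow_le_rpow ha hab hm.le
    have h2 := (Real.rpow_pos_of_pos hs.2.1 q).le
    have h3 := mul_le_mul_of_nonneg_left h1 h2
    simp only [hF]
    linarith
  have hlevelBig : ∀ c : ℝ, B < |c| →
      (∀ᶠ s in 𝓝[>] 0, c ≤ p s) ∨ (∀ᶠ s in 𝓝[>] 0, p s ≤ c) := by
    intro c hc
    obtain ⟨d, hd, hdF⟩ := hbig _ hc
    refine eventually_ge_or_le_of_deriv_pos hpd ?_
    filter_upwards [hdF, hev] with s hs hs0 hpc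
    rw [hpc]
    have := hs0.1
    have h2 : 0 < F |c| s := hd.trans hs
    positivity
  have hlevelSmall : ∀ c : ℝ, |c| < B →
      (∀ᶠ s in 𝓝[>] 0, c ≤ p s) ∨ (∀ᶠ s in 𝓝[>] 0, p s ≤ c) := by
    intro c hc
    obtain ⟨d, hd, hdF⟩ := hsmall _ (abs_nonneg c) hc
    refine eventually_ge_or_le_of_deriv_neg hpd ?_
    filter_upwards [hdF, hev] with s hs hs0 hpc
    rw [hpc]
    have := hs0.1
    exact div_neg_of_neg_of_pos (by linarith) (by positivity)
  have hnotBig : ∀ b, B < b → ¬ ∀ᶠ s in 𝓝[>] 0, b ≤ |p s| := by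
    intro b hb hcon
    obtain ⟨d, hd, hdF⟩ := hbig b hb
    have h1 := eventually_mul_le_of_le_sq_mul_deriv (c := d / σ) (by positivity) hpd (by
      filter_upwards [hdF, hsq, hFmono, hcon] with s h1 h2 h3 h4
      rw [h2]
      have := h3 b |p s| (hB.trans hb).le h4
      gcongr
      linarith)
    have h2 := le_of_tendsto hw h1
    have : 0 < d / σ := by positivity
    linarith
  have hnotSmall : ∀ b, 0 ≤ b → b < B → ¬ ∀ᶠ s in 𝓝[>] 0, |p s| ≤ b := by
    intro b hb0 hb hcon
    obtain ⟨d, hd, hdF⟩ := hsmall b hb0 hb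
    have h1 := eventually_le_mul_of_sq_mul_deriv_le (c := d / σ) (by positivity) hpd (by
      filter_upwards [hdF, hsq, hFmono, hcon] with s h1 h2 h3 h4
      rw [h2, ← neg_div]
      have := h3 |p s| b (abs_nonneg _) h4
      gcongr
      linarith)
    have h2 := ge_of_tendsto hw h1
    have : 0 < d / σ := by positivity
    linarith
  have hdich : ∀ η, 0 < η → η < B →
      (∀ᶠ s in 𝓝[>] 0, |p s - B| ≤ η) ∨ (∀ᶠ s in 𝓝[>] 0, |p s - -B| ≤ η) := by
    intro η hη hηB
    have hup : ∀ᶠ s in 𝓝[>] 0, p s ≤ B + η := by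
      rcases hlevelBig (B + η) (by rw [abs_of_pos (by linarith)]; linarith) with h1 | h1
      · exact absurd (h1.mono fun s hs => hs.trans (le_abs_self _)) (hnotBig (B + η) (by linarith))
      · exact h1
    have hlo : ∀ᶠ s in 𝓝[>] 0, -(B + η) ≤ p s := by
      rcases hlevelBig (-(B + η)) (by rw [abs_neg, abs_of_pos (by linarith)]; linarith)
        with h1 | h1
      · exact h1
      · refine absurd (h1.mono fun s hs => ?_) (hnotBig (B + η) (by linarith))
        exact le_trans (by linarith) (neg_le_abs _)
    rcases hlevelSmall (B - η) (by rw [abs_of_pos (by linarith)]; linarith) with h1 | h1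
    · left
      filter_upwards [h1, hup] with s hs1 hs2
      exact abs_le.mpr ⟨by linarith, by linarith⟩
    · rcases hlevelSmall (-(B - η)) (by rw [abs_neg, abs_of_pos (by linarith)]; linarith)
        with h2 | h2
      · refine absurd ?_ (hnotSmall (B - η) (by linarith) (by linarith))
        filter_upwards [h1, h2] with s hs1 hs2
        exact abs_le.mpr ⟨hs2, hs1⟩
      · right
        filter_upwards [h2, hlo] with s hs1 hs2
        exact abs_le.mpr ⟨by linarith, by linarith⟩
  have hfin : ∀ l, (∀ η, 0 < η → η < B → ∀ᶠ s in 𝓝[>] 0, |p s - l| ≤ η) →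
      Tendsto p (𝓝[>] 0) (𝓝 l) := by
    intro l hl
    rw [Metric.tendsto_nhds]
    intro δ hδ
    have hmin : 0 < min (δ / 2) (B / 2) := lt_min (by linarith) (by linarith)
    filter_upwards [hl _ hmin ((min_le_right _ _).trans_lt (by linarith))] with s hs
    rw [Real.dist_eq]
    exact hs.trans_lt ((min_le_left _ _).trans_lt (by linarith))
  by_cases hall : ∀ η, 0 < η → η < B → ∀ᶠ s in 𝓝[>] 0, |p s - B| ≤ η
  · exact Or.inl (hfin B hall)
  · simp only [not_forall] at hall
    obtain ⟨η₀, hη₀, hη₀B, hnot⟩ := hall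
    refine Or.inr (hfin (-B) fun η hη hηB => ?_)
    have hmin : 0 < min η η₀ := lt_min hη hη₀
    rcases hdich _ hmin ((min_le_left _ _).trans_lt hηB) with h1 | h1
    · exact absurd (h1.mono fun s hs => hs.trans (min_le_right _ _)) hnot
    · exact h1.mono fun s hs => hs.trans (min_le_left _ _)

/-! ### Expansion to fourth order -/

/-- Strict differentiability of the nonlinearity `v^q |p|^m - λ v` at `(γ, ε B)`, `ε = ±1`. -/
theorem exists_nonlinearity_approx {lam m q γ B ε : ℝ} (hγ : 0 < γ) (hB : 0 < B)
    (hε : ε = 1 ∨ ε = -1) {c : ℝ} (hc : 0 < c) :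
    ∃ δ > 0, ∀ v w p r : ℝ, |v - γ| < δ → |w - γ| < δ → |p - ε * B| < δ → |r - ε * B| < δ →
      |(v ^ q * |p| ^ m - lam * v) - (w ^ q * |r| ^ m - lam * w)
        - ((q * γ ^ (q - 1) * B ^ m - lam) * (v - w)
          + ε * (m * γ ^ q * B ^ (m - 1)) * (p - r))| ≤ c * (|v - w| + |p - r|) := by
  have hεB : |ε * B| = B := by
    rcases hε with rfl | rfl <;> simp [abs_of_pos hB]
  have hεB0 : ε * B ≠ 0 := by
    rw [← abs_pos, hεB]
    exact hB
  have habs : HasStrictDerivAt (fun p : ℝ => |p|) ε (ε * B) := by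
    rcases hε with rfl | rfl
    · simpa using hasStrictDerivAt_abs_pos (x := 1 * B) (by linarith)
    · simpa using hasStrictDerivAt_abs_neg (x := -1 * B) (by linarith)
  have h1 : HasStrictDerivAt (fun v : ℝ => v ^ q) (q * γ ^ (q - 1)) γ :=
    Real.hasStrictDerivAt_rpow_const_of_ne hγ.ne' q
  have h2 : HasStrictDerivAt (fun p : ℝ => |p| ^ m) (m * B ^ (m - 1) * ε) (ε * B) := by
    have := (Real.hasStrictDerivAt_rpow_const_of_ne (x := |ε * B|) (by rw [hεB]; exact hB.ne')
      m).comp (ε * B) habs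
    rwa [hεB] at this
  have h3 := ((h1.comp_hasStrictFDerivAt (γ, ε * B) hasStrictFDerivAt_fst).mul
    (h2.comp_hasStrictFDerivAt (γ, ε * B) hasStrictFDerivAt_snd)).sub
    ((hasStrictFDerivAt_fst (𝕜 := ℝ) (p := (γ, ε * B))).const_mul lam)
  have h4 := Asymptotics.isLittleO_iff.mp h3.isLittleO hc
  obtain ⟨δ, hδ, H⟩ := Metric.eventually_nhds_iff.mp h4
  refine ⟨δ, hδ, fun v w p r hv hw hp hr => ?_⟩
  have := @H ((v, p), (w, r)) (by
    simp only [Prod.dist_eq, Real.dist_eq, max_lt_iff]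
    exact ⟨⟨hv, hp⟩, hw, hr⟩)
  simp only [Function.comp, Real.norm_eq_abs, hεB] at this
  refine le_trans (le_of_eq ?_) (this.trans ?_)
  · congr 1
    simp
    ring
  · refine mul_le_mul_of_nonneg_left ?_ hc.le
    rw [Prod.norm_def]
    exact max_le (le_add_of_nonneg_right (abs_nonneg _)) (le_add_of_nonneg_left (abs_nonneg _))

/-- Second order Taylor expansion of `U^q Q^m` for polynomials with `U(0) = Q(0) = 1`. -/
theorem rpow_mul_rpow_taylor (q m u₁ u₂ u₃ c₁ c₂ : ℝ) :
    (fun s : ℝ => (1 + u₁ * s + u₂ * s ^ 2 + u₃ * s ^ 3) ^ q * (1 + c₁ * s + c₂ * s ^ 2) ^ m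
      - (1 + (q * u₁ + m * c₁) * s
        + (q * u₂ + q * (q - 1) / 2 * u₁ ^ 2 + q * m * u₁ * c₁ + m * c₂
          + m * (m - 1) / 2 * c₁ ^ 2) * s ^ 2)) =o[𝓝[>] 0] fun s => s ^ 2 := by
  set U : ℝ → ℝ := fun s => 1 + u₁ * s + u₂ * s ^ 2 + u₃ * s ^ 3 with hU
  set Q : ℝ → ℝ := fun s => 1 + c₁ * s + c₂ * s ^ 2 with hQ
  set U' : ℝ → ℝ := fun s => u₁ + 2 * u₂ * s + 3 * u₃ * s ^ 2 with hU'
  set Q' : ℝ → ℝ := fun s => c₁ + 2 * c₂ * s with hQ'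
  have dU : ∀ s, HasDerivAt U (U' s) s := by
    intro s
    refine (((((hasDerivAt_id s).const_mul u₁).const_add 1).add
      ((hasDerivAt_pow 2 s).const_mul u₂)).add ((hasDerivAt_pow 3 s).const_mul u₃)).congr_deriv ?_
    simp [hU']
    ring
  have dQ : ∀ s, HasDerivAt Q (Q' s) s := by
    intro s
    refine ((((hasDerivAt_id s).const_mul c₁).const_add 1).add
      ((hasDerivAt_pow 2 s).const_mul c₂)).congr_deriv ?_
    simp [hQ']
    ring
  have dU' : HasDerivAt U' (2 * u₂) 0 := by
    refine ((((hasDerivAt_id (0 : ℝ)).const_mul (2 * u₂)).const_add u₁).add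
      ((hasDerivAt_pow 2 (0 : ℝ)).const_mul (3 * u₃))).congr_deriv ?_
    simp
  have dQ' : HasDerivAt Q' (2 * c₂) 0 := by
    refine (((hasDerivAt_id (0 : ℝ)).const_mul (2 * c₂)).const_add c₁).congr_deriv ?_
    simp
  have U0 : U 0 = 1 := by simp [hU]
  have Q0 : Q 0 = 1 := by simp [hQ]
  have U0' : U' 0 = u₁ := by simp [hU']
  have Q0' : Q' 0 = c₁ := by simp [hQ']
  have hpU : ∀ᶠ s in 𝓝 (0 : ℝ), 0 < U s := by
    have := (dU 0).continuousAt.tendsto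
    rw [U0] at this
    exact this.eventually (lt_mem_nhds one_pos)
  have hpQ : ∀ᶠ s in 𝓝 (0 : ℝ), 0 < Q s := by
    have := (dQ 0).continuousAt.tendsto
    rw [Q0] at this
    exact this.eventually (lt_mem_nhds one_pos)
  set A := q * u₁ + m * c₁ with hA
  set D := q * u₂ + q * (q - 1) / 2 * u₁ ^ 2 + q * m * u₁ * c₁ + m * c₂
          + m * (m - 1) / 2 * c₁ ^ 2 with hD
  have dpow : ∀ (G G' : ℝ → ℝ) (r s : ℝ), HasDerivAt G (G' s) s → 0 < G s →
      HasDerivAt (fun s => G s ^ r) (G' s * r * G s ^ (r - 1)) s :=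
    fun G G' r s h h0 => h.rpow_const (Or.inl h0.ne')
  have dφ : ∀ᶠ s in 𝓝 (0 : ℝ), HasDerivAt
      (fun s => U s ^ q * Q s ^ m - (1 + A * s + D * s ^ 2))
      (U' s * q * U s ^ (q - 1) * Q s ^ m + U s ^ q * (Q' s * m * Q s ^ (m - 1))
        - (A + 2 * D * s)) s := by
    filter_upwards [hpU, hpQ] with s h1 h2
    refine (((dpow U U' q s (dU s) h1).mul (dpow Q Q' m s (dQ s) h2)).sub
      ((((hasDerivAt_id s).const_mul A).const_add 1).add
      ((hasDerivAt_pow 2 s).const_mul D))).congr_deriv ?_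
    simp
    ring
  have hU00 : 0 < U 0 := by rw [U0]; exact one_pos
  have hQ00 : 0 < Q 0 := by rw [Q0]; exact one_pos
  have ddφ : HasDerivAt (fun s => U' s * q * U s ^ (q - 1) * Q s ^ m
      + U s ^ q * (Q' s * m * Q s ^ (m - 1)) - (A + 2 * D * s)) 0 0 := by
    refine (((((dU'.mul_const q).mul (dpow U U' (q - 1) 0 (dU 0) hU00)).mul
      (dpow Q Q' m 0 (dQ 0) hQ00)).add ((dpow U U' q 0 (dU 0) hU00).mul
      ((dQ'.mul_const m).mul (dpow Q Q' (m - 1) 0 (dQ 0) hQ00)))).sub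
      (((hasDerivAt_id (0 : ℝ)).const_mul (2 * D)).const_add A)).congr_deriv ?_
    simp only [U0, Q0, U0', Q0', Real.one_rpow, hD, Pi.mul_apply]
    ring
  refine isLittleO_pow_succ_of_deriv (k := 1) (dφ.filter_mono nhdsWithin_le_nhds) ?_ ?_
  · have h0 := dφ.self_of_nhds.continuousAt.tendsto
    simp only [U0, Q0, Real.one_rpow] at h0
    norm_num at h0
    exact h0.mono_left nhdsWithin_le_nhds
  · have h0 := ddφ.isLittleO.mono (nhdsWithin_le_nhds (s := Ioi 0))
    simp only [U0, Q0, U0', Q0', Real.one_rpow] at h0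
    refine (h0.congr (fun s => ?_) (fun s => ?_))
    · simp [hA]
      ring
    · simp

/-- Two solutions of the reduced system up to `o(s²)` that have the same slope `ε B` at `0`
agree to order `s³`. -/
theorem isLittleO_sub_of_approx_solution {σ β lam m q S γ B ε : ℝ} {v p V P P' : ℝ → ℝ}
    (h : IsReducedSolution σ β lam m q S v p) (hS : 0 < S) (hσ : 0 < σ) (hm : 0 < m)
    (hγ : 0 < γ) (hB : 0 < B) (hε : ε = 1 ∨ ε = -1)
    (hl : Tendsto v (𝓝[>] 0) (𝓝 γ)) (hp : Tendsto p (𝓝[>] 0) (𝓝 (ε * B)))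
    (hV : ∀ᶠ s in 𝓝[>] 0, HasDerivAt V (P s / σ) s)
    (hP : ∀ᶠ s in 𝓝[>] 0, HasDerivAt P (P' s) s)
    (hVl : Tendsto V (𝓝[>] 0) (𝓝 γ)) (hPl : Tendsto P (𝓝[>] 0) (𝓝 (ε * B)))
    (hE : (fun s => V s ^ q * |P s| ^ m - lam * V s - β * s * P s - σ * s ^ 2 * P' s)
      =o[𝓝[>] 0] fun s => s ^ 2) :
    (fun s => v s - V s) =o[𝓝[>] 0] (fun s => s ^ 3) ∧
      (fun s => p s - P s) =o[𝓝[>] 0] fun s => s ^ 2 := by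
  have hev := h.eventually hS
  have hε0 : ε ≠ 0 := by rcases hε with rfl | rfl <;> norm_num
  set E : ℝ → ℝ := fun s => V s ^ q * |P s| ^ m - lam * V s - β * s * P s - σ * s ^ 2 * P' s
    with hE_def
  set a := q * γ ^ (q - 1) * B ^ m - lam with ha
  set b := ε * (m * γ ^ q * B ^ (m - 1)) with hb
  have hb0 : b ≠ 0 := mul_ne_zero hε0 (by positivity)
  set Z : ℝ → ℝ := fun s => p s - P s with hZ
  set W : ℝ → ℝ := fun s => v s - V s with hW
  set N : ℝ → ℝ → ℝ := fun v p => v ^ q * |p| ^ m - lam * v with hN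
  have hZl : Tendsto Z (𝓝[>] 0) (𝓝 0) := by simpa using hp.sub hPl
  have hWl : Tendsto W (𝓝[>] 0) (𝓝 0) := by simpa using hl.sub hVl
  have dW : ∀ᶠ s in 𝓝[>] 0, HasDerivAt W (Z s / σ) s := by
    filter_upwards [hev, hV] with s h1 h2
    refine (h1.2.2.1.sub h2).congr_deriv ?_
    rw [hZ]
    ring
  set Z' : ℝ → ℝ := fun s => (v s ^ q * |p s| ^ m - lam * v s - β * s * p s) / (σ * s ^ 2) - P' s
    with hZ'
  have dZ : ∀ᶠ s in 𝓝[>] 0, HasDerivAt Z (Z' s) s := by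
    filter_upwards [hev, hP] with s h1 h2
    exact h1.2.2.2.sub h2
  have hrem : (fun s => N (v s) (p s) - N (V s) (P s) - (a * W s + b * Z s))
      =o[𝓝[>] 0] fun s => |W s| + |Z s| := by
    rw [Asymptotics.isLittleO_iff]
    intro c hc
    obtain ⟨δ, hδ, H⟩ := exists_nonlinearity_approx (lam := lam) (m := m) (q := q) hγ hB hε hc
    have near : ∀ (f : ℝ → ℝ) (l : ℝ), Tendsto f (𝓝[>] 0) (𝓝 l) →
        ∀ᶠ s in 𝓝[>] 0, |f s - l| < δ := fun f l hf => by
      simpa only [Real.dist_eq] using (Metric.tendsto_nhds.mp hf) δ hδ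
    filter_upwards [near _ _ hl, near _ _ hVl, near _ _ hp, near _ _ hPl] with s h1 h2 h3 h4
    rw [Real.norm_eq_abs, Real.norm_of_nonneg (by positivity)]
    exact H _ _ _ _ h1 h2 h3 h4
  have key : ∀ k : ℕ, k ≤ 2 → (W =o[𝓝[>] 0] fun s => s ^ k) → Z =o[𝓝[>] 0] fun s => s ^ k := by
    intro k hk hWk
    refine isLittleO_pow_of_sq_mul_deriv (g := b / σ) (div_ne_zero hb0 hσ.ne') dZ hZl ?_
    have hpos : ∀ᶠ s in 𝓝[>] (0 : ℝ), 0 < s := self_mem_nhdsWithin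
    have hT1 : (fun s => s ^ k) =O[𝓝[>] 0] fun s => |Z s| + s ^ k :=
      Asymptotics.IsBigO.of_bound 1 (by
        filter_upwards [hpos] with s hs
        rw [Real.norm_of_nonneg (by positivity), Real.norm_of_nonneg (by positivity), one_mul]
        exact le_add_of_nonneg_left (abs_nonneg _))
    have hT2 : (fun s => |Z s|) =O[𝓝[>] 0] fun s => |Z s| + s ^ k :=
      Asymptotics.IsBigO.of_bound 1 (by
        filter_upwards [hpos] with s hs
        rw [Real.norm_of_nonneg (abs_nonneg _), Real.norm_of_nonneg (by positivity), one_mul]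
        exact le_add_of_nonneg_right (by positivity))
    have hWT : W =o[𝓝[>] 0] fun s => |Z s| + s ^ k := hWk.trans_isBigO hT1
    have hET : E =o[𝓝[>] 0] fun s => |Z s| + s ^ k := by
      refine (hE.trans_isBigO ?_).trans_isBigO hT1
      refine Asymptotics.IsBigO.of_bound 1 ?_
      filter_upwards [Ioo_mem_nhdsGT (show (0 : ℝ) < 1 by norm_num)] with s hs
      have := hs.1
      rw [Real.norm_of_nonneg (by positivity), Real.norm_of_nonneg (by positivity), one_mul]
      exact pow_le_pow_of_le_one hs.1.le hs.2.le hk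
    have hsZ : (fun s => s * Z s) =o[𝓝[>] 0] fun s => |Z s| + s ^ k := by
      have h1 : (fun s : ℝ => s) =o[𝓝[>] 0] fun _ => (1 : ℝ) := by
        rw [Asymptotics.isLittleO_one_iff]
        exact tendsto_id.mono_left nhdsWithin_le_nhds
      have h2 := (h1.mul_isBigO (Asymptotics.isBigO_refl Z (𝓝[>] 0))).abs_right
      simp only [one_mul] at h2
      exact h2.trans_isBigO hT2
    have hrT := hrem.trans_isBigO (hWT.isBigO.abs_left.add hT2)
    refine ((((hrT.add (hWT.const_mul_left a)).sub (hsZ.const_mul_left β)).add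
      hET).const_mul_left σ⁻¹).congr' ?_ Filter.EventuallyEq.rfl
    filter_upwards [hpos] with s hs
    simp only [hN, hZ', hE_def, hZ, hW]
    field_simp
    ring
  have hdiv : ∀ k : ℕ, (Z =o[𝓝[>] 0] fun s => s ^ k) →
      (fun s => Z s / σ) =o[𝓝[>] 0] fun s => s ^ k := fun k hk => by
    simpa only [div_eq_inv_mul] using hk.const_mul_left σ⁻¹
  have W1 : W =o[𝓝[>] 0] fun s => s ^ 1 :=
    isLittleO_pow_succ_of_deriv (k := 0) dW hWl (hdiv 0 (by
      simp only [pow_zero]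
      rwa [Asymptotics.isLittleO_one_iff]))
  have W2 := isLittleO_pow_succ_of_deriv dW hWl (hdiv 1 (key 1 (by norm_num) W1))
  have Z2 := key 2 le_rfl W2
  exact ⟨isLittleO_pow_succ_of_deriv dW hWl (hdiv 2 Z2), Z2⟩

/-- The expansion of `v` and of the slope `p` for a solution with `p → ε B`. The coefficients
`β₁`, `β₂` are determined by requiring the residual of the truncated series to be `o(s²)`. -/
theorem IsReducedSolution.expansion {σ β lam m q S γ B ε a β₁ β₂ D₁ D₂ : ℝ} {v p : ℝ → ℝ}
    (h : IsReducedSolution σ β lam m q S v p) (hS : 0 < S) (hσ : 0 < σ) (hm : 0 < m)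
    (hlam : 0 < lam) (hγ : 0 < γ) (hB : 0 < B) (hε : ε = 1 ∨ ε = -1)
    (hBm : γ ^ q * B ^ m = lam * γ) (ha : a = B / (σ * γ))
    (hD₁ : D₁ = σ * β + lam * (1 - q))
    (hD₂ : D₂ = (2 - m) * D₁ - 2 * lam * m * q + (2 * σ + β) * σ)
    (hβ₁ : β₁ = a ^ 2 * (D₁ / (2 * lam * m)))
    (hβ₂ : β₂ = a ^ 3 * ((D₁ * D₂ + lam ^ 2 * m * q * (1 - q)) / (6 * lam ^ 2 * m ^ 2)))
    (hl : Tendsto v (𝓝[>] 0) (𝓝 γ)) (hp : Tendsto p (𝓝[>] 0) (𝓝 (ε * B))) :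
    (fun s => v s - γ * (1 + ε * a * s + β₁ * s ^ 2 + ε * β₂ * s ^ 3))
        =o[𝓝[>] 0] (fun s => s ^ 3) ∧
      (fun s => p s - σ * γ * (ε * a + 2 * β₁ * s + 3 * ε * β₂ * s ^ 2))
        =o[𝓝[>] 0] fun s => s ^ 2 := by
  have ha0 : 0 < a := by rw [ha]; positivity
  have hBa : B = σ * γ * a := by rw [ha]; field_simp
  have hε2 : ε ^ 2 = 1 := by rcases hε with rfl | rfl <;> norm_num
  have hPl : Tendsto (fun s => σ * γ * (ε * a + 2 * β₁ * s + 3 * ε * β₂ * s ^ 2)) (𝓝[>] 0)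
      (𝓝 (ε * B)) := by
    have : Continuous fun s : ℝ => σ * γ * (ε * a + 2 * β₁ * s + 3 * ε * β₂ * s ^ 2) := by
      fun_prop
    convert (this.tendsto 0).mono_left nhdsWithin_le_nhds using 2
    rw [hBa]
    ring
  have hVl : Tendsto (fun s => γ * (1 + ε * a * s + β₁ * s ^ 2 + ε * β₂ * s ^ 3)) (𝓝[>] 0)
      (𝓝 γ) := by
    have : Continuous fun s : ℝ => γ * (1 + ε * a * s + β₁ * s ^ 2 + ε * β₂ * s ^ 3) := by
      fun_prop
    convert (this.tendsto 0).mono_left nhdsWithin_le_nhds using 2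
    ring
  refine isLittleO_sub_of_approx_solution
    (P' := fun s => σ * γ * (2 * β₁ + 6 * ε * β₂ * s))
    h hS hσ hm hγ hB hε hl hp ?_ ?_ hVl hPl ?_
  · refine Eventually.of_forall fun s => ?_
    refine ((((((hasDerivAt_id s).const_mul (ε * a)).const_add 1).add
      ((hasDerivAt_pow 2 s).const_mul β₁)).add
      ((hasDerivAt_pow 3 s).const_mul (ε * β₂))).const_mul γ).congr_deriv ?_
    simp
    field_simp
  · refine Eventually.of_forall fun s => ?_
    refine (((((hasDerivAt_id s).const_mul (2 * β₁)).const_add (ε * a)).add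
      ((hasDerivAt_pow 2 s).const_mul (3 * ε * β₂))).const_mul (σ * γ)).congr_deriv ?_
    simp only [mul_one, Nat.cast_ofNat, Nat.add_one_sub_one, pow_one]
    ring
  · set U : ℝ → ℝ := fun s => 1 + ε * a * s + β₁ * s ^ 2 + ε * β₂ * s ^ 3 with hU
    set Q : ℝ → ℝ := fun s => 1 + 2 * ε * β₁ / a * s + 3 * β₂ / a * s ^ 2 with hQ
    have hPQ : ∀ s, σ * γ * (ε * a + 2 * β₁ * s + 3 * ε * β₂ * s ^ 2) = ε * (B * Q s) := by
      intro s
      rw [hBa, hQ]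
      field_simp
      linear_combination (-2 * β₁ * s) * hε2
    have hUpos : ∀ᶠ s in 𝓝[>] (0 : ℝ), 0 < U s := by
      have hc : Continuous U := by fun_prop
      have : Tendsto U (𝓝[>] 0) (𝓝 (U 0)) := (hc.tendsto 0).mono_left nhdsWithin_le_nhds
      exact this.eventually (lt_mem_nhds (by simp [hU]))
    have hQpos : ∀ᶠ s in 𝓝[>] (0 : ℝ), 0 < Q s := by
      have hc : Continuous Q := by fun_prop
      have : Tendsto Q (𝓝[>] 0) (𝓝 (Q 0)) := (hc.tendsto 0).mono_left nhdsWithin_le_nhds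
      exact this.eventually (lt_mem_nhds (by simp [hQ]))
    have hT := (rpow_mul_rpow_taylor q m (ε * a) β₁ (ε * β₂) (2 * ε * β₁ / a)
      (3 * β₂ / a)).const_mul_left (lam * γ)
    have hcub : (fun s : ℝ => (lam * γ * (ε * β₂) + 9 * β * σ * γ * ε * β₂ / 3
        + 6 * σ ^ 2 * γ * ε * β₂) * s ^ 3) =o[𝓝[>] 0] fun s => s ^ 2 :=
      ((Asymptotics.isLittleO_pow_pow (by norm_num : 2 < 3)).mono
        nhdsWithin_le_nhds).const_mul_left _
    refine (hT.sub hcub).congr' ?_ Filter.EventuallyEq.rfl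
    filter_upwards [hUpos, hQpos] with s hs1 hs2
    have hpow : (γ * U s) ^ q * |ε * (B * Q s)| ^ m = lam * γ * (U s ^ q * Q s ^ m) := by
      have : |ε * (B * Q s)| = B * Q s := by
        have h0 : 0 < B * Q s := by positivity
        rcases hε with rfl | rfl <;> simp [abs_of_pos h0]
      rw [this, Real.mul_rpow hγ.le hs1.le, Real.mul_rpow hB.le hs2.le, ← hBm]
      ring
    rw [hPQ s, hpow, ← hPQ s]
    have e1 : q * (ε * a) + m * (2 * ε * β₁ / a) = ε * a * (lam + σ * β) / lam := by
      rw [hβ₁, hD₁]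
      field_simp
      ring
    have e2 : q * β₁ + q * (q - 1) / 2 * (ε * a) ^ 2 + q * m * (ε * a) * (2 * ε * β₁ / a)
        + m * (3 * β₂ / a) + m * (m - 1) / 2 * (2 * ε * β₁ / a) ^ 2
        = (lam + 2 * β * σ + 2 * σ ^ 2) * β₁ / lam := by
      have e3 : q * β₁ + q * (q - 1) / 2 * (ε * a) ^ 2 + q * m * (ε * a) * (2 * ε * β₁ / a)
        + m * (3 * β₂ / a) + m * (m - 1) / 2 * (2 * ε * β₁ / a) ^ 2
        = q * β₁ + q * (q - 1) / 2 * a ^ 2 + q * m * 2 * β₁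
        + m * (3 * β₂ / a) + m * (m - 1) / 2 * (2 * β₁ / a) ^ 2 := by
        field_simp
        rw [hε2]
        ring
      rw [e3, hβ₂, hβ₁, hD₂, hD₁]
      field_simp
      ring
    have hUs : 1 + ε * a * s + β₁ * s ^ 2 + ε * β₂ * s ^ 3 = U s := rfl
    have hQs : 1 + 2 * ε * β₁ / a * s + 3 * β₂ / a * s ^ 2 = Q s := rfl
    rw [e1, e2, hUs, hQs]
    generalize U s ^ q * Q s ^ m = X
    simp only [hU]
    field_simp
    ring

/-! ### Exponentially small corrections -/

/-- The scale `s ^ D * exp (-A / s)`. -/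
noncomputable def expScale (A D s : ℝ) : ℝ := s ^ D * Real.exp (-(A / s))

theorem expScale_pos {A D s : ℝ} (hs : 0 < s) : 0 < expScale A D s :=
  mul_pos (Real.rpow_pos_of_pos hs D) (Real.exp_pos _)

theorem expScale_add_two {A D s : ℝ} (hs : 0 < s) :
    expScale A (D + 2) s = s ^ 2 * expScale A D s := by
  rw [expScale, expScale, Real.rpow_add hs]
  norm_num
  ring

theorem expScale_neg {A D s : ℝ} (hs : 0 < s) : expScale (-A) (-D) s = (expScale A D s)⁻¹ := by
  rw [expScale, expScale, Real.rpow_neg hs.le, mul_inv, ← Real.exp_neg, neg_div]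

theorem hasDerivAt_expScale (A D : ℝ) {s : ℝ} (hs : 0 < s) :
    HasDerivAt (expScale A D) ((A / s ^ 2 + D / s) * expScale A D s) s := by
  have h1 : HasDerivAt (fun s : ℝ => -(A * s⁻¹)) (-(A * -(s ^ 2)⁻¹)) s :=
    ((hasDerivAt_inv hs.ne').const_mul A).neg
  have h2 : HasDerivAt (fun s : ℝ => s ^ D) (D * s ^ (D - 1)) s :=
    Real.hasDerivAt_rpow_const (Or.inl hs.ne')
  refine (h2.mul h1.exp).congr_deriv ?_
  rw [Real.rpow_sub_one hs.ne', expScale, ← div_eq_mul_inv]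
  field_simp
  ring

theorem tendsto_expScale_zero {A : ℝ} (hA : 0 < A) (D : ℝ) :
    Tendsto (expScale A D) (𝓝[>] 0) (𝓝 0) := by
  have h := (tendsto_rpow_mul_exp_neg_mul_atTop_nhds_zero (-D) A hA).comp
    tendsto_inv_nhdsGT_zero
  refine h.congr' ?_
  filter_upwards [self_mem_nhdsWithin] with s hs
  have hs0 : (0 : ℝ) < s := hs
  simp only [Function.comp, expScale]
  rw [Real.inv_rpow hs0.le, Real.rpow_neg hs0.le, inv_inv, div_eq_mul_inv, neg_mul]

/-- L'Hôpital's rule on the scales `expScale A D`. -/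
theorem tendsto_div_expScale_of_deriv {f f' : ℝ → ℝ} {A D c : ℝ} (hA : 0 < A)
    (hf : ∀ᶠ s in 𝓝[>] 0, HasDerivAt f (f' s) s) (hl : Tendsto f (𝓝[>] 0) (𝓝 0))
    (h : Tendsto (fun s => f' s / expScale A D s) (𝓝[>] 0) (𝓝 c)) :
    Tendsto (fun s => f s / expScale A (D + 2) s) (𝓝[>] 0) (𝓝 (c / A)) := by
  have hlin : Tendsto (fun s : ℝ => A + (D + 2) * s) (𝓝[>] 0) (𝓝 A) := by
    have hc : Continuous fun s : ℝ => A + (D + 2) * s := by fun_prop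
    simpa using (hc.tendsto 0).mono_left nhdsWithin_le_nhds
  have hder : ∀ s : ℝ, 0 < s → (A / s ^ 2 + (D + 2) / s) * expScale A (D + 2) s
      = expScale A D s * (A + (D + 2) * s) := by
    intro s hs
    rw [expScale_add_two hs]
    field_simp
  refine HasDerivAt.lhopital_zero_nhdsGT hf
    (g' := fun s => (A / s ^ 2 + (D + 2) / s) * expScale A (D + 2) s) ?_ ?_ hl
    (tendsto_expScale_zero hA _) ?_
  · filter_upwards [self_mem_nhdsWithin] with s hs using hasDerivAt_expScale _ _ hs
  · filter_upwards [self_mem_nhdsWithin, hlin.eventually (lt_mem_nhds hA)] with s hs h1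
    rw [hder s hs]
    exact (mul_pos (expScale_pos hs) h1).ne'
  · refine (h.div hlin hA.ne').congr' ?_
    filter_upwards [self_mem_nhdsWithin] with s hs
    simp only [Pi.div_apply]
    rw [hder s hs, div_div]

theorem eventually_eq_of_deriv_eq_zero {f f' : ℝ → ℝ} {l : ℝ}
    (hf : ∀ᶠ s in 𝓝[>] 0, HasDerivAt f (f' s) s) (h : ∀ᶠ s in 𝓝[>] 0, f' s = 0)
    (hl : Tendsto f (𝓝[>] 0) (𝓝 l)) : ∀ᶠ s in 𝓝[>] 0, f s = l := by
  obtain ⟨δ, hδ, H⟩ := eventually_nhdsGT_zero_iff.mp (hf.and h)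
  have h1 := monotoneOn_Ioo_of_hasDerivAt (fun s hs => (H s hs).1) (fun s hs => (H s hs).2.ge)
  have h2 := monotoneOn_Ioo_of_hasDerivAt (f := fun s => -f s) (f' := fun s => -f' s)
    (fun s hs => (H s hs).1.neg) (fun s hs => by rw [(H s hs).2, neg_zero])
  filter_upwards [Ioo_mem_nhdsGT hδ] with s hs
  refine tendsto_nhds_unique (tendsto_const_nhds.congr' ?_) hl
  filter_upwards [Ioo_mem_nhdsGT hs.1] with t ht
  have ht' : t ∈ Ioo 0 δ := ⟨ht.1, ht.2.trans hs.2⟩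
  have h3 := h1 ht' hs ht.2.le
  have h4 := h2 ht' hs ht.2.le
  simp only at h4
  linarith

/-- A solution of `μ' = b μ` with `b` bounded near `0` vanishes near `0` or has a nonzero
limit. -/
theorem eventually_eq_zero_or_tendsto_of_bounded_log_deriv {μ b : ℝ → ℝ} {K : ℝ}
    (hμ : ∀ᶠ s in 𝓝[>] 0, HasDerivAt μ (b s * μ s) s) (hb : ∀ᶠ s in 𝓝[>] 0, |b s| ≤ K) :
    (∀ᶠ s in 𝓝[>] 0, μ s = 0) ∨ ∃ C ≠ 0, Tendsto μ (𝓝[>] 0) (𝓝 C) := by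
  obtain ⟨δ, hδ, H⟩ := eventually_nhdsGT_zero_iff.mp (hμ.and hb)
  have hm : δ / 2 ∈ Ioo 0 δ := ⟨by linarith, by linarith⟩
  have hK : 0 ≤ K := (abs_nonneg _).trans (H _ hm).2
  have hexp : ∀ c s : ℝ, HasDerivAt (fun s => Real.exp (c * s)) (c * Real.exp (c * s)) s := by
    intro c s
    simpa [mul_comm] using ((hasDerivAt_id s).const_mul c).exp
  have hsq : ∀ c : ℝ, ∀ s ∈ Ioo 0 δ, HasDerivAt (fun s => μ s ^ 2 * Real.exp (c * s))
      ((2 * b s + c) * (μ s ^ 2 * Real.exp (c * s))) s := by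
    intro c s hs
    refine (((H s hs).1.pow 2).mul (hexp c s)).congr_deriv ?_
    simp
    ring
  -- `μ² exp (2 K s)` increases and `μ² exp (-2 K s)` decreases
  have hup : MonotoneOn (fun s => μ s ^ 2 * Real.exp (2 * K * s)) (Ioo 0 δ) := by
    refine monotoneOn_Ioo_of_hasDerivAt (hsq (2 * K)) fun s hs => ?_
    have := (abs_le.mp (H s hs).2).1
    exact mul_nonneg (by linarith) (by positivity)
  have hdown : MonotoneOn (fun s => -(μ s ^ 2 * Real.exp (-(2 * K) * s))) (Ioo 0 δ) := by
    refine monotoneOn_Ioo_of_hasDerivAt (fun s hs => (hsq (-(2 * K)) s hs).neg) fun s hs => ?_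
    have := (abs_le.mp (H s hs).2).2
    rw [neg_nonneg]
    exact mul_nonpos_of_nonpos_of_nonneg (by linarith) (by positivity)
  by_cases h0 : μ (δ / 2) = 0
  · left
    filter_upwards [Ioo_mem_nhdsGT hm.1] with s hs
    have h1 := hup ⟨hs.1, hs.2.trans hm.2⟩ hm hs.2.le
    simp only [h0] at h1
    have h2 : μ s ^ 2 * Real.exp (2 * K * s) ≤ 0 := by simpa using h1
    have h3 : μ s ^ 2 ≤ 0 := nonpos_of_mul_nonpos_left h2 (Real.exp_pos _)
    exact pow_eq_zero_iff (two_ne_zero) |>.mp (le_antisymm h3 (sq_nonneg _))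
  · right
    set M := μ (δ / 2) ^ 2 * Real.exp (2 * K * (δ / 2)) with hM
    have hbound : ∀ s ∈ Ioo 0 (δ / 2), μ s ^ 2 ≤ M := by
      intro s hs
      have h1 := hup ⟨hs.1, hs.2.trans hm.2⟩ hm hs.2.le
      refine le_trans ?_ h1
      refine le_mul_of_one_le_right (sq_nonneg _) (Real.one_le_exp ?_)
      have := hs.1
      positivity
    have hlow : ∀ s ∈ Ioo 0 (δ / 2), μ (δ / 2) ^ 2 * Real.exp (-(2 * K) * (δ / 2)) ≤ μ s ^ 2 := by
      intro s hs
      have h1 := hdown ⟨hs.1, hs.2.trans hm.2⟩ hm hs.2.le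
      simp only [neg_le_neg_iff] at h1
      refine h1.trans (mul_le_of_le_one_right (sq_nonneg _) (Real.exp_le_one_iff.mpr ?_))
      have := mul_nonneg hK hs.1.le
      linarith
    have hlip : LipschitzOnWith (K * Real.sqrt M).toNNReal μ (Ioo 0 (δ / 2)) := by
      refine (convex_Ioo 0 (δ / 2)).lipschitzOnWith_of_nnnorm_hasDerivWithin_le
        (f' := fun s => b s * μ s)
        (fun s hs => (H s ⟨hs.1, hs.2.trans hm.2⟩).1.hasDerivWithinAt) fun s hs => ?_
      rw [← NNReal.coe_le_coe, coe_nnnorm, Real.coe_toNNReal _ (by positivity), norm_mul]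
      refine mul_le_mul (H s ⟨hs.1, hs.2.trans hm.2⟩).2 ?_ (norm_nonneg _) hK
      exact Real.abs_le_sqrt (hbound s hs)
    obtain ⟨g, hg, hgμ⟩ := hlip.extend_real
    have hlim : Tendsto μ (𝓝[>] 0) (𝓝 (g 0)) := by
      refine ((hg.continuous.tendsto 0).mono_left nhdsWithin_le_nhds).congr' ?_
      filter_upwards [Ioo_mem_nhdsGT hm.1] with s hs using (hgμ hs).symm
    refine ⟨g 0, fun hg0 => ?_, hlim⟩
    have h1 : μ (δ / 2) ^ 2 * Real.exp (-(2 * K) * (δ / 2)) ≤ g 0 ^ 2 :=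
      ge_of_tendsto (hlim.pow 2) (by
        filter_upwards [Ioo_mem_nhdsGT hm.1] with s hs using hlow s hs)
    have h2 : 0 < μ (δ / 2) ^ 2 * Real.exp (-(2 * K) * (δ / 2)) := by positivity
    rw [hg0, zero_pow two_ne_zero] at h1
    linarith

/-- Solutions of `F' = (A / s² + D / s + O(1)) F`. -/
theorem eventually_eq_zero_or_tendsto_div_expScale {F b : ℝ → ℝ} {A D K : ℝ}
    (hF : ∀ᶠ s in 𝓝[>] 0, HasDerivAt F ((A / s ^ 2 + D / s + b s) * F s) s)
    (hb : ∀ᶠ s in 𝓝[>] 0, |b s| ≤ K) :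
    (∀ᶠ s in 𝓝[>] 0, F s = 0) ∨
      ∃ C ≠ 0, Tendsto (fun s => F s / expScale A D s) (𝓝[>] 0) (𝓝 C) := by
  have hpos : ∀ᶠ s in 𝓝[>] (0 : ℝ), 0 < s := self_mem_nhdsWithin
  have h := eventually_eq_zero_or_tendsto_of_bounded_log_deriv
    (μ := fun s => F s / expScale A D s) (b := b) (K := K) (by
      filter_upwards [hF, hpos] with s h1 hs
      have hE := (expScale_pos (A := A) (D := D) hs).ne'
      refine (h1.div (hasDerivAt_expScale A D hs) hE).congr_deriv ?_
      field_simp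
      ring) hb
  refine h.imp (fun h => ?_) id
  filter_upwards [h, hpos] with s h1 hs
  exact (div_eq_zero_iff.mp h1).resolve_right (expScale_pos hs).ne'

/-- The degenerate case `D₁ = 0`, `q ∈ {0, 1}`. The residual `F = v^q |p|^m - λ v - β s p`, which
equals `σ s² p'`, then satisfies a scalar linear homogeneous equation. Hence either it vanishes
near `0`, and `v` is affine, or it is of the exact order `s ^ D exp (-A / s)`; this is
incompatible with `F → 0` when the slope is negative. -/
theorem IsReducedSolution.affine_or_exponential {σ β lam m q S γ B ε : ℝ} {v p : ℝ → ℝ}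
    (h : IsReducedSolution σ β lam m q S v p) (hS : 0 < S) (hσ : 0 < σ) (hm : 0 < m)
    (hγ : 0 < γ) (hB : 0 < B) (hε : ε = 1 ∨ ε = -1)
    (hBm : γ ^ q * B ^ m = lam * γ) (hq : q = 0 ∨ q = 1) (hβ : σ * β + lam * (1 - q) = 0)
    (hl : Tendsto v (𝓝[>] 0) (𝓝 γ)) (hp : Tendsto p (𝓝[>] 0) (𝓝 (ε * B)))
    (hv3 : (fun s => v s - (γ + ε * B / σ * s)) =o[𝓝[>] 0] fun s => s ^ 3)
    (hp2 : (fun s => p s - ε * B) =o[𝓝[>] 0] fun s => s ^ 2) :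
    (∀ᶠ s in 𝓝[>] 0, v s = γ + ε * B / σ * s) ∨
      (ε = 1 ∧ ∃ C ≠ 0, Tendsto (fun s => (v s - (γ + ε * B / σ * s)) /
        expScale (m * γ ^ q * B ^ (m - 1) / σ) (q * m * B ^ m / σ ^ 2 - β / σ + 2) s)
        (𝓝[>] 0) (𝓝 C)) := by
  have hev := h.eventually hS
  have hpos : ∀ᶠ s in 𝓝[>] (0 : ℝ), 0 < s := self_mem_nhdsWithin
  have hid : Tendsto (fun s : ℝ => s) (𝓝[>] 0) (𝓝 0) := tendsto_id.mono_left nhdsWithin_le_nhds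
  have hε2 : ε * ε = 1 := by rcases hε with rfl | rfl <;> norm_num
  have hεB : |ε * B| = B := by rcases hε with rfl | rfl <;> simp [abs_of_pos hB]
  set D := q * m * B ^ m / σ ^ 2 - β / σ with hD
  set A := m * γ ^ q * B ^ (m - 1) / σ with hA
  have hA0 : 0 < A := by positivity
  set F : ℝ → ℝ := fun s => v s ^ q * |p s| ^ m - lam * v s - β * s * p s with hF
  have hsign : ∀ᶠ s in 𝓝[>] 0, 0 < ε * p s := by
    have h1 := hp.const_mul ε
    rw [← mul_assoc, hε2, one_mul] at h1
    exact h1.eventually (lt_mem_nhds hB)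
  have habs : ∀ p : ℝ, 0 < ε * p → HasDerivAt (fun p : ℝ => |p|) ε p := by
    intro p hp
    rcases hε with rfl | rfl
    · simpa using hasDerivAt_abs_pos (x := p) (by linarith)
    · simpa using hasDerivAt_abs_neg (x := p) (by linarith)
  have hFl : Tendsto F (𝓝[>] 0) (𝓝 0) := by
    have h1 : Tendsto F (𝓝[>] 0)
        (𝓝 (γ ^ q * |ε * B| ^ m - lam * γ - β * 0 * (ε * B))) :=
      (((hl.rpow_const (Or.inl hγ.ne')).mul
        (hp.abs.rpow_const (Or.inl (by rw [hεB]; exact hB.ne')))).sub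
        (hl.const_mul lam)).sub ((hid.const_mul β).mul hp)
    rw [hεB, hBm] at h1
    simpa using h1
  have dp : ∀ᶠ s in 𝓝[>] 0, HasDerivAt p (F s / (σ * s ^ 2)) s := by
    filter_upwards [hev] with s hs using hs.2.2.2
  have dF : ∀ᶠ s in 𝓝[>] 0, HasDerivAt F
      ((ε * m * |p s| ^ (m - 1) * v s ^ q / (σ * s ^ 2) - β / (σ * s)
        + q * p s / (σ * v s)) * F s) s := by
    filter_upwards [hev, dp, hsign] with s h1 h2 h3
    obtain ⟨hs0, hv0, hdv, -⟩ := h1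
    have hp0 : 0 < |p s| := abs_pos.mpr (by rintro h0; simp [h0] at h3)
    have hpm : |p s| ^ m = |p s| ^ (m - 1) * |p s| := by
      rw [← Real.rpow_add_one hp0.ne']
      ring_nf
    have dabs : HasDerivAt (fun s => |p s|) (ε * (F s / (σ * s ^ 2))) s :=
      (habs _ h3).comp s h2
    have d := (((hdv.rpow_const (p := q) (Or.inl hv0.ne')).mul
      (dabs.rpow_const (p := m) (Or.inl hp0.ne'))).sub (hdv.const_mul lam)).sub
      (((hasDerivAt_id s).const_mul β).mul h2)
    refine d.congr_deriv ?_
    have hlamβ : lam * (1 - q) = -(σ * β) := by linarith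
    have key : q * v s ^ (q - 1) * |p s| ^ m - lam - σ * β = q * F s / v s := by
      rcases hq with rfl | rfl
      · simp only [zero_mul, zero_div]
        linarith
      · have hβ0 : β = 0 := by
          have : σ * β = 0 := by linarith
          exact (mul_eq_zero.mp this).resolve_left hσ.ne'
        simp only [hF, hβ0, sub_self, Real.rpow_zero, Real.rpow_one]
        field_simp
        ring
    have e1 : p s / σ * (q * v s ^ (q - 1) * |p s| ^ m - lam - σ * β)
        = q * p s / (σ * v s) * F s := by
      rw [key]
      field_simp
    simp only [id]
    rw [add_mul, ← e1]
    field_simp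
    ring
  -- expansion of the coefficient of `F`
  have hψ : (fun s => |p s| ^ (m - 1) - B ^ (m - 1)) =O[𝓝[>] 0] fun s => s ^ 2 := by
    have hd : HasDerivAt (fun p : ℝ => |p| ^ (m - 1)) _ (ε * B) :=
      (habs (ε * B) (by rw [← mul_assoc, hε2, one_mul]; exact hB)).rpow_const
        (Or.inl (by rw [hεB]; exact hB.ne'))
    have := hd.isBigO_sub.comp_tendsto hp
    simp only [Function.comp_def, hεB] at this
    exact this.trans hp2.isBigO
  have hvq : (fun s => v s ^ q - (γ ^ q + q * (ε * B / σ * s))) =O[𝓝[>] 0] fun s => s ^ 2 := by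
    rcases hq with rfl | rfl
    · simpa using Asymptotics.isBigO_zero _ _
    · simp only [Real.rpow_one, one_mul]
      refine hv3.isBigO.trans ?_
      exact ((Asymptotics.isLittleO_pow_pow (by norm_num : 2 < 3)).mono
        nhdsWithin_le_nhds).isBigO
  have hcoef : (fun s => ε * m * |p s| ^ (m - 1) * v s ^ q
      - ε * m * B ^ (m - 1) * (γ ^ q + q * (ε * B / σ * s))) =O[𝓝[>] 0] fun s => s ^ 2 := by
    have hvb : (fun s => v s ^ q) =O[𝓝[>] 0] fun _ => (1 : ℝ) :=
      (hl.rpow_const (Or.inl hγ.ne')).isBigO_one ℝ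
    have h1 := (hψ.mul hvb).const_mul_left (ε * m)
    have h2 := hvq.const_mul_left (ε * m * B ^ (m - 1))
    simp only [mul_one] at h1
    refine (h1.add h2).congr_left fun s => ?_
    ring
  set b : ℝ → ℝ := fun s => (ε * m * |p s| ^ (m - 1) * v s ^ q
      - ε * m * B ^ (m - 1) * (γ ^ q + q * (ε * B / σ * s))) / (σ * s ^ 2) + q * p s / (σ * v s)
    with hb
  have hbO : b =O[𝓝[>] 0] fun _ => (1 : ℝ) := by
    have h1 : (fun s => (ε * m * |p s| ^ (m - 1) * v s ^ q
      - ε * m * B ^ (m - 1) * (γ ^ q + q * (ε * B / σ * s))) / (σ * s ^ 2))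
      =O[𝓝[>] 0] fun _ => (1 : ℝ) := by
      obtain ⟨c, hc⟩ := hcoef.bound
      refine Asymptotics.IsBigO.of_bound (c / σ) ?_
      filter_upwards [hc, hpos] with s h1 hs
      rw [norm_div, Real.norm_of_nonneg (by positivity : 0 ≤ σ * s ^ 2), norm_one, mul_one,
        div_le_div_iff₀ (by positivity) hσ]
      rw [Real.norm_of_nonneg (by positivity : (0:ℝ) ≤ s ^ 2)] at h1
      calc _ ≤ c * s ^ 2 * σ := mul_le_mul_of_nonneg_right h1 hσ.le
        _ = _ := by ring
    exact h1.add (((hp.const_mul q).div (hl.const_mul σ) (by positivity)).isBigO_one ℝ)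
  obtain ⟨K, hK⟩ := hbO.bound
  have hlin : ∀ᶠ s in 𝓝[>] 0, HasDerivAt F ((ε * A / s ^ 2 + D / s + b s) * F s) s := by
    filter_upwards [dF, hpos] with s h1 hs
    refine h1.congr_deriv ?_
    congr 1
    have hBm1 : B ^ m = B ^ (m - 1) * B := by
      rw [← Real.rpow_add_one hB.ne']
      ring_nf
    simp only [hb, hD, hA, hBm1]
    field_simp
    linear_combination (B * m * q * s * B ^ (m - 1)) * hε2
  rcases eventually_eq_zero_or_tendsto_div_expScale (K := K) hlin
    (hK.mono fun s hs => by simpa using hs) with hzero | ⟨C, hC, hlim⟩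
  · left
    have hpc : ∀ᶠ s in 𝓝[>] 0, p s = ε * B :=
      eventually_eq_of_deriv_eq_zero dp (hzero.mono fun s hs => by rw [hs, zero_div]) hp
    have hW : ∀ᶠ s in 𝓝[>] 0, v s - ε * B / σ * s = γ :=
      eventually_eq_of_deriv_eq_zero (f := fun s => v s - ε * B / σ * s)
        (f' := fun s => p s / σ - ε * B / σ * 1)
        (hev.mono fun s hs => hs.2.2.1.sub ((hasDerivAt_id s).const_mul _))
        (hpc.mono fun s hs => by rw [hs]; ring)
        (by simpa using hl.sub (hid.const_mul (ε * B / σ)))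
    filter_upwards [hW] with s hs
    linarith
  · right
    rcases hε with rfl | rfl
    · refine ⟨rfl, C / σ / A / σ / A, by positivity, ?_⟩
      simp only [one_mul] at hlim hp hp2 hv3 ⊢
      have hpB : Tendsto (fun s => p s - B) (𝓝[>] 0) (𝓝 0) := by
        simpa using hp.sub_const B
      have h1 : Tendsto (fun s => (p s - B) / expScale A (D - 2 + 2) s) (𝓝[>] 0)
          (𝓝 (C / σ / A)) := by
        refine tendsto_div_expScale_of_deriv hA0
          (dp.mono fun s hs => hs.sub_const B) hpB ?_
        refine (hlim.div_const σ).congr' ?_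
        filter_upwards [hpos] with s hs
        have : expScale A D s = s ^ 2 * expScale A (D - 2) s := by
          rw [← expScale_add_two hs, sub_add_cancel]
        have hE := (expScale_pos (A := A) (D := D - 2) hs).ne'
        rw [this]
        field_simp
      rw [sub_add_cancel] at h1
      refine tendsto_div_expScale_of_deriv (f' := fun s => (p s - B) / σ) hA0 ?_ ?_ ?_
      · filter_upwards [hev] with s hs
        refine (hs.2.2.1.sub (((hasDerivAt_id s).const_mul (B / σ)).const_add γ)).congr_deriv ?_
        ring
      · have := hl.sub ((hid.const_mul (B / σ)).const_add γ)
        simpa using this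
      · refine (h1.div_const σ).congr fun s => ?_
        rw [div_right_comm]
    · exfalso
      have h1 : Tendsto (fun s => F s * expScale A (-D) s) (𝓝[>] 0) (𝓝 (0 * 0)) :=
        hFl.mul (tendsto_expScale_zero hA0 _)
      have h2 : Tendsto (fun s => F s * expScale A (-D) s) (𝓝[>] 0) (𝓝 C) := by
        refine hlim.congr' ?_
        filter_upwards [hpos] with s hs
        have h3 := expScale_neg (A := -A) (D := D) hs
        rw [neg_neg] at h3
        rw [h3, neg_one_mul, div_eq_mul_inv]
      rw [mul_zero] at h1
      exact hC (tendsto_nhds_unique h2 h1)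

/-! ### Existence by a fixed point argument -/

open MeasureTheory
open scoped BoundedContinuousFunction

theorem integrableOn_exp_mul_bounded {κ : ℝ} (hκ : 0 < κ) (h : ℝ →ᵇ ℝ) (a : ℝ) :
    IntegrableOn (fun t => Real.exp (-κ * t) * h t) (Ioi a) :=
  (exp_neg_integrableOn_Ioi a hκ).mul_bdd h.continuous.aestronglyMeasurable
    (Eventually.of_forall fun t => h.norm_coe_le_norm t)

/-- The bounded solution `exp (κ τ) ∫_τ^∞ exp (-κ t) h t dt` of `y' = κ y - h`. -/
noncomputable def expTail (κ : ℝ) (h : ℝ →ᵇ ℝ) (τ : ℝ) : ℝ :=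
  Real.exp (κ * τ) * ∫ t in Ioi τ, Real.exp (-κ * t) * h t

theorem hasDerivAt_expTail {κ : ℝ} (hκ : 0 < κ) (h : ℝ →ᵇ ℝ) (τ : ℝ) :
    HasDerivAt (expTail κ h) (κ * expTail κ h τ - h τ) τ := by
  have hc : Continuous fun t => Real.exp (-κ * t) * h t :=
    (Real.continuous_exp.comp (continuous_const.mul continuous_id)).mul h.continuous
  have hJ : ∀ t, ∫ x in Ioi t, Real.exp (-κ * x) * h x
      = (∫ x in Ioi 0, Real.exp (-κ * x) * h x) - ∫ x in (0 : ℝ)..t, Real.exp (-κ * x) * h x := by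
    intro t
    rw [← intervalIntegral.integral_interval_add_Ioi
      (integrableOn_exp_mul_bounded hκ h 0) (integrableOn_exp_mul_bounded hκ h t)]
    ring
  have hd : HasDerivAt (fun t => ∫ x in Ioi t, Real.exp (-κ * x) * h x)
      (-(Real.exp (-κ * τ) * h τ)) τ :=
    ((hc.integral_hasStrictDerivAt 0 τ).hasDerivAt.const_sub _).congr_of_eventuallyEq
      (Eventually.of_forall hJ)
  have he : HasDerivAt (fun t => Real.exp (κ * t)) (Real.exp (κ * τ) * (κ * 1)) τ :=
    ((hasDerivAt_id τ).const_mul κ).exp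
  refine (he.mul hd).congr_deriv ?_
  have : Real.exp (κ * τ) * Real.exp (-κ * τ) = 1 := by
    rw [← Real.exp_add]
    simp
  rw [expTail]
  linear_combination (-h τ) * this

theorem abs_expTail_le {κ : ℝ} (hκ : 0 < κ) (h : ℝ →ᵇ ℝ) (τ : ℝ) :
    |expTail κ h τ| ≤ κ⁻¹ * ‖h‖ := by
  have h1 : ‖∫ t in Ioi τ, Real.exp (-κ * t) * h t‖
      ≤ ∫ t in Ioi τ, Real.exp (-κ * t) * ‖h‖ := by
    refine norm_integral_le_of_norm_le ((exp_neg_integrableOn_Ioi τ hκ).mul_const _) ?_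
    refine Eventually.of_forall fun t => ?_
    rw [norm_mul, Real.norm_of_nonneg (Real.exp_pos _).le]
    gcongr
    exact h.norm_coe_le_norm t
  rw [integral_mul_const, integral_exp_mul_Ioi (by linarith : -κ < 0)] at h1
  rw [expTail, abs_mul, abs_of_pos (Real.exp_pos _), ← Real.norm_eq_abs]
  calc _ ≤ Real.exp (κ * τ) * (-Real.exp (-κ * τ) / -κ * ‖h‖) := by gcongr
    _ = (Real.exp (κ * τ) * Real.exp (-κ * τ)) * (κ⁻¹ * ‖h‖) := by
      field_simp
    _ = κ⁻¹ * ‖h‖ := by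
      rw [← Real.exp_add]
      simp

theorem expTail_sub {κ : ℝ} (hκ : 0 < κ) (h g : ℝ →ᵇ ℝ) (τ : ℝ) :
    expTail κ h τ - expTail κ g τ = expTail κ (h - g) τ := by
  rw [expTail, expTail, expTail, ← mul_sub,
    ← integral_sub (integrableOn_exp_mul_bounded hκ h τ) (integrableOn_exp_mul_bounded hκ g τ)]
  congr 2
  ext t
  simp
  ring

/-- For `ε = ±1`, the equation `y' = ε (h - κ y)` has a solution operator on bounded continuous
functions with norm at most `1 / κ`. -/
theorem exists_bounded_solution_operator {κ ε : ℝ} (hκ : 0 < κ) (hε : ε = 1 ∨ ε = -1) :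
    ∃ T : (ℝ →ᵇ ℝ) → (ℝ →ᵇ ℝ),
      (∀ h τ, HasDerivAt (T h) (ε * (h τ - κ * T h τ)) τ) ∧
      (∀ h, ‖T h‖ ≤ κ⁻¹ * ‖h‖) ∧ ∀ h g, ‖T h - T g‖ ≤ κ⁻¹ * ‖h - g‖ := by
  rcases hε with rfl | rfl
  · set r : (ℝ →ᵇ ℝ) → (ℝ →ᵇ ℝ) := fun h => h.compContinuous ⟨fun t => -t, continuous_neg⟩
      with hr
    have hrn : ∀ h, ‖r h‖ ≤ ‖h‖ := fun h =>
      (BoundedContinuousFunction.norm_le (norm_nonneg _)).mpr fun t => h.norm_coe_le_norm _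
    have hd : ∀ h τ, HasDerivAt (fun τ => expTail κ (r h) (-τ))
        (1 * (h τ - κ * expTail κ (r h) (-τ))) τ := by
      intro h τ
      refine ((hasDerivAt_expTail hκ (r h) (-τ)).comp τ (hasDerivAt_neg τ)).congr_deriv ?_
      simp [hr]
    have hb : ∀ h τ, ‖expTail κ (r h) (-τ)‖ ≤ κ⁻¹ * ‖h‖ := fun h τ =>
      (abs_expTail_le hκ (r h) (-τ)).trans (by gcongr; exact hrn h)
    refine ⟨fun h => BoundedContinuousFunction.ofNormedAddCommGroup
      (fun τ => expTail κ (r h) (-τ))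
      (continuous_iff_continuousAt.mpr fun τ => (hd h τ).continuousAt) _ (hb h),
      hd, fun h => ?_, fun h g => ?_⟩
    · exact (BoundedContinuousFunction.norm_le (by positivity)).mpr (hb h)
    · refine (BoundedContinuousFunction.norm_le (by positivity)).mpr fun τ => ?_
      have h1 : r h - r g = r (h - g) := by
        ext t
        simp [hr]
      have h2 := hb (h - g) τ
      rwa [← h1, ← expTail_sub hκ] at h2
  · refine ⟨fun h => BoundedContinuousFunction.ofNormedAddCommGroup (expTail κ h)
      (continuous_iff_continuousAt.mpr fun τ => (hasDerivAt_expTail hκ h τ).continuousAt) _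
      (abs_expTail_le hκ h), fun h τ => ?_, fun h => ?_, fun h g => ?_⟩
    · refine (hasDerivAt_expTail hκ h τ).congr_deriv ?_
      simp
    · exact (BoundedContinuousFunction.norm_le (by positivity)).mpr (abs_expTail_le hκ h)
    · refine (BoundedContinuousFunction.norm_le (by positivity)).mpr fun τ => ?_
      have h2 := abs_expTail_le hκ (h - g) τ
      rwa [← expTail_sub hκ] at h2

/-- Truncation of a real number to `[-η, η]`. -/
def truncate (η x : ℝ) : ℝ := max (-η) (min η x)

theorem continuous_truncate (η : ℝ) : Continuous (truncate η) := by
  unfold truncate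
  fun_prop

theorem abs_truncate_le {η : ℝ} (hη : 0 ≤ η) (x : ℝ) : |truncate η x| ≤ η :=
  abs_le.mpr ⟨le_max_left _ _, max_le (by linarith) (min_le_left _ _)⟩

theorem truncate_of_abs_le {η x : ℝ} (hx : |x| ≤ η) : truncate η x = x := by
  have := abs_le.mp hx
  rw [truncate, min_eq_right this.2, max_eq_right this.1]

theorem abs_truncate_sub_le (η x y : ℝ) : |truncate η x - truncate η y| ≤ |x - y| := by
  refine (abs_max_sub_max_le_max _ _ _ _).trans (max_le (by simp) ?_)
  exact (abs_min_sub_min_le_max _ _ _ _).trans (max_le (by simp) le_rfl)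

/-- The function with value `γ` at `0` and derivative `(e + truncate η (Z (1 / s))) / σ`. -/
noncomputable def profileOf (γ σ e η : ℝ) (Z : ℝ →ᵇ ℝ) (s : ℝ) : ℝ :=
  γ + σ⁻¹ * ∫ t in (0 : ℝ)..s, (e + truncate η (Z t⁻¹))

theorem measurable_slope_integrand (e η : ℝ) (Z : ℝ →ᵇ ℝ) :
    Measurable fun t : ℝ => e + truncate η (Z t⁻¹) :=
  (((continuous_truncate η).comp Z.continuous).measurable.comp measurable_inv).const_add e

theorem intervalIntegrable_slope_integrand {e η : ℝ} (hη : 0 ≤ η) (Z : ℝ →ᵇ ℝ) (a b : ℝ) :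
    IntervalIntegrable (fun t : ℝ => e + truncate η (Z t⁻¹)) volume a b := by
  refine (intervalIntegrable_const (c := |e| + η)).mono_fun
    (measurable_slope_integrand e η Z).aestronglyMeasurable (Eventually.of_forall fun t => ?_)
  rw [Real.norm_of_nonneg (by positivity : 0 ≤ |e| + η)]
  exact (abs_add_le _ _).trans (add_le_add le_rfl (abs_truncate_le hη _))

theorem continuous_profileOf {γ σ e η : ℝ} (hη : 0 ≤ η) (Z : ℝ →ᵇ ℝ) :
    Continuous (profileOf γ σ e η Z) :=
  ((intervalIntegral.continuous_primitive
    (intervalIntegrable_slope_integrand hη Z) 0).const_mul σ⁻¹).const_add γ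

theorem hasDerivAt_profileOf {γ σ e η s : ℝ} (hη : 0 ≤ η) (Z : ℝ →ᵇ ℝ) (hs : 0 < s) :
    HasDerivAt (profileOf γ σ e η Z) ((e + truncate η (Z s⁻¹)) / σ) s := by
  have hc : ContinuousAt (fun t : ℝ => e + truncate η (Z t⁻¹)) s :=
    continuousAt_const.add (((continuous_truncate η).comp Z.continuous).continuousAt.comp
      (continuousAt_inv₀ hs.ne'))
  have := intervalIntegral.integral_hasDerivAt_right
    (intervalIntegrable_slope_integrand (e := e) hη Z 0 s)
    (measurable_slope_integrand e η Z).stronglyMeasurable.stronglyMeasurableAtFilter hc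
  refine ((this.const_mul σ⁻¹).const_add γ).congr_deriv ?_
  rw [div_eq_inv_mul]

theorem abs_profileOf_sub_le {γ σ e η s : ℝ} (hσ : 0 < σ) (hη : 0 ≤ η) (Z : ℝ →ᵇ ℝ)
    (hs : 0 ≤ s) : |profileOf γ σ e η Z s - γ| ≤ (|e| + η) * s / σ := by
  have := intervalIntegral.norm_integral_le_of_norm_le_const (a := 0) (b := s)
    (f := fun t : ℝ => e + truncate η (Z t⁻¹)) (C := |e| + η)
    (fun t _ => (abs_add_le _ _).trans (add_le_add le_rfl (abs_truncate_le hη _)))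
  rw [sub_zero, abs_of_nonneg hs] at this
  rw [profileOf, add_sub_cancel_left, abs_mul, abs_of_pos (inv_pos.mpr hσ), ← div_eq_inv_mul]
  gcongr
  exact this

theorem abs_profileOf_sub_profileOf_le {γ σ e η s : ℝ} (hσ : 0 < σ) (hη : 0 ≤ η)
    (Z Y : ℝ →ᵇ ℝ) (hs : 0 ≤ s) :
    |profileOf γ σ e η Z s - profileOf γ σ e η Y s| ≤ ‖Z - Y‖ * s / σ := by
  have := intervalIntegral.norm_integral_le_of_norm_le_const (a := 0) (b := s)
    (f := fun t : ℝ => (e + truncate η (Z t⁻¹)) - (e + truncate η (Y t⁻¹))) (C := ‖Z - Y‖)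
    (fun t _ => by
      rw [add_sub_add_left_eq_sub]
      exact (abs_truncate_sub_le _ _ _).trans ((Z - Y).norm_coe_le_norm t⁻¹))
  rw [sub_zero, abs_of_nonneg hs, intervalIntegral.integral_sub
    (intervalIntegrable_slope_integrand hη Z 0 s)
    (intervalIntegrable_slope_integrand hη Y 0 s)] at this
  rw [profileOf, profileOf, add_sub_add_left_eq_sub, ← mul_sub, abs_mul,
    abs_of_pos (inv_pos.mpr hσ), ← div_eq_inv_mul]
  gcongr
  exact this

/-- Solutions of the reduced system with `v → γ` and slope near `ε B`. In the variable `τ = 1 / s`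
the deviation `Z = p - ε B` solves `Z' = -ε κ Z - G[Z]`, where `G` has a small Lipschitz constant
when `Z` is small and `τ` large. For `ε = 1` the homogeneous equation decays as `τ → ∞`, and the
value `z` of the homogeneous part at the initial time is a free parameter; for `ε = -1` only
`z = 0` is admissible. -/
theorem exists_reduced_solutions {σ β lam m q γ B ε : ℝ} (hσ : 0 < σ) (hm : 0 < m) (hq : 0 ≤ q)
    (hγ : 0 < γ) (hB : 0 < B) (hBm : γ ^ q * B ^ m = lam * γ) (hε : ε = 1 ∨ ε = -1) :
    ∃ S₀ > 0, ∃ η > 0, ∀ S, 0 < S → S ≤ S₀ → ∃ v p : ℝ → ℝ → ℝ,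
      (∀ z, |z| ≤ η → (ε = 1 ∨ z = 0) → IsReducedSolution σ β lam m q S (v z) (p z) ∧
        Tendsto (v z) (𝓝[>] 0) (𝓝 γ) ∧ ∀ s ∈ Ioo 0 S, |p z s - ε * B| ≤ B / 2) ∧
      ∀ z z', |z| ≤ η → |z'| ≤ η → (ε = 1 ∨ z = 0) → (ε = 1 ∨ z' = 0) →
        EqOn (p z) (p z') (Ioo 0 S) → z = z' := by
  have hγq : 0 < γ ^ q := Real.rpow_pos_of_pos hγ q
  have hε2 : ε * ε = 1 := by rcases hε with rfl | rfl <;> norm_num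
  have hεabs : |ε| = 1 := by rcases hε with rfl | rfl <;> norm_num
  have hεB : |ε * B| = B := by rw [abs_mul, hεabs, one_mul, abs_of_pos hB]
  set κ := m * γ ^ q * B ^ (m - 1) / σ with hκ_def
  have hκ : 0 < κ := by positivity
  have hκσ : m * γ ^ q * B ^ (m - 1) = κ * σ := by rw [hκ_def]; field_simp
  set a := q * γ ^ (q - 1) * B ^ m - lam with ha
  set c := σ * κ / 8 with hc_def
  have hc : 0 < c := by positivity
  obtain ⟨δ, hδ, happ⟩ := exists_nonlinearity_approx (lam := lam) (m := m) (q := q) hγ hB hε hc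
  set η := min (δ / 2) (B / 2) with hη_def
  have hη : 0 < η := lt_min (by linarith) (by linarith)
  have hηδ : η < δ := (min_le_left _ _).trans_lt (by linarith)
  have hηB : η ≤ B / 2 := min_le_right _ _
  set M := (B + η) / σ with hM
  have hM0 : 0 < M := by positivity
  set L := (|a| + c) / σ + |β| with hL
  have hL0 : 0 < L := by positivity
  -- the smallness conditions on `S`
  obtain ⟨S₀, hS₀, hsm1, hsm2, hsm3⟩ : ∃ S₀ > 0, M * S₀ < δ ∧ M * S₀ < γ ∧
      S₀ * (B + η) * L ≤ c * η := by
    have hden : 0 < (B + η) * L := by positivity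
    refine ⟨min (min (δ / 2 / M) (γ / 2 / M)) (c * η / ((B + η) * L)), by positivity, ?_, ?_, ?_⟩
    · have : min (min (δ / 2 / M) (γ / 2 / M)) (c * η / ((B + η) * L)) ≤ δ / 2 / M :=
        (min_le_left _ _).trans (min_le_left _ _)
      rw [le_div_iff₀ hM0] at this
      linarith
    · have : min (min (δ / 2 / M) (γ / 2 / M)) (c * η / ((B + η) * L)) ≤ γ / 2 / M :=
        (min_le_left _ _).trans (min_le_right _ _)
      rw [le_div_iff₀ hM0] at this
      linarith
    · have : min (min (δ / 2 / M) (γ / 2 / M)) (c * η / ((B + η) * L))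
          ≤ c * η / ((B + η) * L) := min_le_right _ _
      rw [le_div_iff₀ hden] at this
      linarith
  refine ⟨S₀, hS₀, η / 2, by positivity, fun S hS hSS₀ => ?_⟩
  set τ₀ := S⁻¹ with hτ₀
  have hτ₀0 : 0 < τ₀ := inv_pos.mpr hS
  have hinv : ∀ τ : ℝ, 0 < (max τ₀ τ)⁻¹ ∧ (max τ₀ τ)⁻¹ ≤ S₀ := by
    intro τ
    have h1 : τ₀ ≤ max τ₀ τ := le_max_left _ _
    refine ⟨inv_pos.mpr (hτ₀0.trans_le h1), le_trans ?_ hSS₀⟩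
    rw [inv_le_comm₀ (hτ₀0.trans_le h1) hS]
    exact h1
  set V := profileOf γ σ (ε * B) η with hV
  set N : ℝ → ℝ → ℝ := fun v p => v ^ q * |p| ^ m - lam * v with hN
  have hN0 : N γ (ε * B) = 0 := by
    simp only [hN, hεB, hBm, sub_self]
  set H : (ℝ →ᵇ ℝ) → ℝ → ℝ := fun Z τ =>
    N (V Z (max τ₀ τ)⁻¹) (ε * B + truncate η (Z (max τ₀ τ)))
      - β * (max τ₀ τ)⁻¹ * (ε * B + truncate η (Z (max τ₀ τ)))
      - ε * (κ * σ) * truncate η (Z (max τ₀ τ)) with hH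
  have hVb : ∀ Z s, 0 < s → s ≤ S₀ → |V Z s - γ| ≤ M * S₀ := by
    intro Z s hs hsS
    refine (abs_profileOf_sub_le hσ hη.le Z hs.le).trans ?_
    rw [hεB, hM, div_mul_eq_mul_div]
    gcongr
  have hHb : ∀ Z τ, |H Z τ| ≤ 2 * c * η := by
    intro Z τ
    obtain ⟨hs0, hsS⟩ := hinv τ
    set s := (max τ₀ τ)⁻¹
    set y := truncate η (Z (max τ₀ τ)) with hy
    have hy1 : |y| ≤ η := abs_truncate_le hη.le _
    have h1 := happ (V Z s) γ (ε * B + y) (ε * B) ((hVb Z s hs0 hsS).trans_lt hsm1)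
      (by simpa using hδ) (by simpa using hy1.trans_lt hηδ) (by simpa using hδ)
    have hN0' : γ ^ q * |ε * B| ^ m - lam * γ = 0 := hN0
    rw [hN0', add_sub_cancel_left, hκσ] at h1
    have h2 : |V Z s - γ| ≤ (B + η) * S₀ / σ := by
      have := hVb Z s hs0 hsS
      rwa [hM, div_mul_eq_mul_div] at this
    have h3 : |β * s * (ε * B + y)| ≤ |β| * S₀ * (B + η) := by
      rw [abs_mul, abs_mul, abs_of_pos hs0]
      gcongr
      exact (abs_add_le _ _).trans (by rw [hεB]; gcongr)
    have h4 : |a * (V Z s - γ)| ≤ |a| * ((B + η) * S₀ / σ) := by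
      rw [abs_mul]
      gcongr
    have h5 : H Z τ = (N (V Z s) (ε * B + y) - 0 - (a * (V Z s - γ) + ε * (κ * σ) * y))
        + a * (V Z s - γ) - β * s * (ε * B + y) := by
      simp only [hH]
      ring
    rw [h5]
    have h6 : c * (|V Z s - γ| + |y|) ≤ c * ((B + η) * S₀ / σ + η) := by gcongr
    have h7 : (|a| + c) * ((B + η) * S₀ / σ) + |β| * S₀ * (B + η) = S₀ * (B + η) * L := by
      rw [hL]
      field_simp
    calc _ ≤ c * ((B + η) * S₀ / σ + η) + |a| * ((B + η) * S₀ / σ) + |β| * S₀ * (B + η) := by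
          refine (abs_sub _ _).trans (add_le_add ((abs_add_le _ _).trans ?_) h3)
          exact add_le_add (h1.trans h6) h4
      _ ≤ _ := by linarith
  have hHL : ∀ Z Y τ, |H Z τ - H Y τ| ≤ 2 * c * ‖Z - Y‖ := by
    intro Z Y τ
    obtain ⟨hs0, hsS⟩ := hinv τ
    set s := (max τ₀ τ)⁻¹
    set y := truncate η (Z (max τ₀ τ)) with hy
    set x := truncate η (Y (max τ₀ τ)) with hx
    have hy1 : |y| ≤ η := abs_truncate_le hη.le _
    have hx1 : |x| ≤ η := abs_truncate_le hη.le _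
    have hyx : |y - x| ≤ ‖Z - Y‖ :=
      (abs_truncate_sub_le _ _ _).trans ((Z - Y).norm_coe_le_norm _)
    have h1 := happ (V Z s) (V Y s) (ε * B + y) (ε * B + x) ((hVb Z s hs0 hsS).trans_lt hsm1)
      ((hVb Y s hs0 hsS).trans_lt hsm1) (by simpa using hy1.trans_lt hηδ)
      (by simpa using hx1.trans_lt hηδ)
    rw [add_sub_add_left_eq_sub, hκσ] at h1
    have h2 : |V Z s - V Y s| ≤ ‖Z - Y‖ * S₀ / σ := by
      refine (abs_profileOf_sub_profileOf_le hσ hη.le Z Y hs0.le).trans ?_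
      gcongr
    have h3 : |β * s * (y - x)| ≤ |β| * S₀ * ‖Z - Y‖ := by
      rw [abs_mul, abs_mul, abs_of_pos hs0]
      gcongr
    have h4 : |a * (V Z s - V Y s)| ≤ |a| * (‖Z - Y‖ * S₀ / σ) := by
      rw [abs_mul]
      gcongr
    have h5 : H Z τ - H Y τ = (N (V Z s) (ε * B + y) - N (V Y s) (ε * B + x)
        - (a * (V Z s - V Y s) + ε * (κ * σ) * (y - x)))
        + a * (V Z s - V Y s) - β * s * (y - x) := by
      simp only [hH]
      ring
    rw [h5]
    have h6 : c * (|V Z s - V Y s| + |y - x|) ≤ c * (‖Z - Y‖ * S₀ / σ + ‖Z - Y‖) := by gcongr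
    have h7 : (|a| + c) * (‖Z - Y‖ * S₀ / σ) + |β| * S₀ * ‖Z - Y‖ = S₀ * L * ‖Z - Y‖ := by
      rw [hL]
      field_simp
    have h8 : S₀ * L ≤ c := by
      have h9 : S₀ * L * η ≤ c * η := by
        refine le_trans ?_ hsm3
        have : S₀ * (B + η) * L = S₀ * L * (B + η) := by ring
        rw [this]
        gcongr
        linarith
      exact le_of_mul_le_mul_right h9 hη
    have h10 := mul_le_mul_of_nonneg_right h8 (norm_nonneg (Z - Y))
    calc _ ≤ c * (‖Z - Y‖ * S₀ / σ + ‖Z - Y‖) + |a| * (‖Z - Y‖ * S₀ / σ)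
            + |β| * S₀ * ‖Z - Y‖ := by
          refine (abs_sub _ _).trans (add_le_add ((abs_add_le _ _).trans ?_) h3)
          exact add_le_add (h1.trans h6) h4
      _ ≤ _ := by linarith
  have hHc : ∀ Z, Continuous (H Z) := by
    intro Z
    have hmax : Continuous fun τ : ℝ => max τ₀ τ := continuous_const.max continuous_id
    have hinvc : Continuous fun τ : ℝ => (max τ₀ τ)⁻¹ :=
      hmax.inv₀ fun τ => (hτ₀0.trans_le (le_max_left _ _)).ne'
    have hVc : Continuous fun τ : ℝ => V Z (max τ₀ τ)⁻¹ :=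
      (continuous_profileOf hη.le Z).comp hinvc
    have hZc : Continuous fun τ : ℝ => truncate η (Z (max τ₀ τ)) :=
      (continuous_truncate η).comp (Z.continuous.comp hmax)
    have hpc := hZc.const_add (ε * B)
    exact ((((hVc.rpow_const fun _ => Or.inr hq).mul
      (hpc.abs.rpow_const fun _ => Or.inr hm.le)).sub (hVc.const_mul lam)).sub
      ((hinvc.const_mul β).mul hpc)).sub (hZc.const_mul _)
  set G : (ℝ →ᵇ ℝ) → (ℝ →ᵇ ℝ) := fun Z => BoundedContinuousFunction.ofNormedAddCommGroup
    (fun τ => H Z τ / σ) ((hHc Z).div_const σ) (κ * η / 4) (fun τ => by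
      rw [norm_div, Real.norm_of_nonneg hσ.le, div_le_iff₀ hσ]
      refine (hHb Z τ).trans (le_of_eq ?_)
      rw [hc_def]
      ring) with hG
  have hGb : ∀ Z, ‖G Z‖ ≤ κ * η / 4 := fun Z =>
    BoundedContinuousFunction.norm_ofNormedAddCommGroup_le _ (by positivity) _
  have hGL : ∀ Z Y, ‖G Z - G Y‖ ≤ κ / 4 * ‖Z - Y‖ := by
    intro Z Y
    refine (BoundedContinuousFunction.norm_le (by positivity)).mpr fun τ => ?_
    change ‖H Z τ / σ - H Y τ / σ‖ ≤ _
    rw [← sub_div, norm_div, Real.norm_of_nonneg hσ.le, div_le_iff₀ hσ]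
    refine (hHL Z Y τ).trans (le_of_eq ?_)
    rw [hc_def]
    ring
  obtain ⟨T, hTd, hTb, hTL⟩ := exists_bounded_solution_operator hκ hε
  set ζ : ℝ → (ℝ →ᵇ ℝ) := fun z => BoundedContinuousFunction.ofNormedAddCommGroup
    (fun τ => z * Real.exp (-κ * (max τ₀ τ - τ₀))) (by fun_prop) |z| (fun τ => by
      rw [norm_mul, Real.norm_eq_abs, Real.norm_of_nonneg (Real.exp_pos _).le]
      refine mul_le_of_le_one_right (abs_nonneg _) (Real.exp_le_one_iff.mpr ?_)
      have h1 : 0 ≤ max τ₀ τ - τ₀ := sub_nonneg.mpr (le_max_left _ _)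
      have := mul_nonneg hκ.le h1
      linarith) with hζ
  have hζb : ∀ z, ‖ζ z‖ ≤ |z| := fun z =>
    BoundedContinuousFunction.norm_ofNormedAddCommGroup_le _ (abs_nonneg _) _
  set μ : C(ℝ, ℝ) := ⟨fun τ => max τ₀ τ, by fun_prop⟩ with hμ
  set Ψ : ℝ → (ℝ →ᵇ ℝ) → (ℝ →ᵇ ℝ) := fun z Z => (ζ z - ε • T (G Z)).compContinuous μ with hΨ
  have hΨc : ∀ z, ContractingWith (1 / 2) (Ψ z) := by
    intro z
    refine ⟨by rw [div_lt_one] <;> norm_num, LipschitzWith.of_dist_le_mul fun Z Y => ?_⟩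
    rw [dist_eq_norm, dist_eq_norm]
    refine (BoundedContinuousFunction.norm_le (by positivity)).mpr fun τ => ?_
    have h1 : (Ψ z Z - Ψ z Y) τ = -(ε * (T (G Z) - T (G Y)) (μ τ)) := by
      simp [hΨ]
      ring
    rw [h1, norm_neg, norm_mul, Real.norm_eq_abs, hεabs, one_mul]
    calc _ ≤ ‖T (G Z) - T (G Y)‖ := (T (G Z) - T (G Y)).norm_coe_le_norm _
      _ ≤ κ⁻¹ * (κ / 4 * ‖Z - Y‖) := (hTL _ _).trans (by gcongr; exact hGL Z Y)
      _ = 1 / 4 * ‖Z - Y‖ := by field_simp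
      _ ≤ _ := by
        push_cast
        gcongr
        norm_num
  have hfix : ∀ z, ∃ Z, Ψ z Z = Z := fun z => ⟨_, (hΨc z).fixedPoint_isFixedPt⟩
  choose Z hZ using hfix
  have hZτ : ∀ z τ, Z z τ = z * Real.exp (-κ * (max τ₀ τ - τ₀))
      - ε * T (G (Z z)) (max τ₀ τ) := by
    intro z τ
    conv_lhs => rw [← hZ z]
    simp [hΨ, hζ, hμ]
  have hZb : ∀ z, |z| ≤ η / 2 → ∀ τ, |Z z τ| ≤ η := by
    intro z hz τ
    have h1 : Z z τ = ζ z τ - ε * T (G (Z z)) (max τ₀ τ) := hZτ z τ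
    rw [h1]
    have h2 : |ζ z τ| ≤ η / 2 := ((ζ z).norm_coe_le_norm τ).trans ((hζb z).trans hz)
    have h3 : |T (G (Z z)) (max τ₀ τ)| ≤ η / 4 := by
      refine ((T (G (Z z))).norm_coe_le_norm _).trans ((hTb _).trans ?_)
      calc _ ≤ κ⁻¹ * (κ * η / 4) := by gcongr; exact hGb _
        _ = η / 4 := by field_simp
    refine (abs_sub _ _).trans ?_
    rw [abs_mul, hεabs, one_mul]
    linarith
  refine ⟨fun z => V (Z z), fun z s => ε * B + Z z s⁻¹, fun z hz hεz => ⟨⟨?_, ?_, ?_⟩, ?_, ?_⟩, ?_⟩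
  · intro s hs
    have h1 := (abs_le.mp ((hVb (Z z) s hs.1 (hs.2.le.trans hSS₀)))).1
    linarith
  · intro s hs
    have := hasDerivAt_profileOf (γ := γ) (σ := σ) (e := ε * B) hη.le (Z z) hs.1
    rwa [truncate_of_abs_le (hZb z hz _)] at this
  · intro s hs
    have hs0 := hs.1
    have hτ : τ₀ < s⁻¹ := by
      rw [hτ₀]
      exact inv_strictAnti₀ hs.1 hs.2
    have hloc : Z z =ᶠ[𝓝 s⁻¹] fun t => z * Real.exp (-κ * (t - τ₀)) - ε * T (G (Z z)) t := by
      filter_upwards [lt_mem_nhds hτ] with t ht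
      rw [hZτ z t, max_eq_right ht.le]
    have hexp : HasDerivAt (fun t => z * Real.exp (-κ * (t - τ₀)))
        (z * (Real.exp (-κ * (s⁻¹ - τ₀)) * (-κ * 1))) s⁻¹ :=
      ((((hasDerivAt_id s⁻¹).sub_const τ₀).const_mul (-κ)).exp).const_mul z
    have hdZ : HasDerivAt (Z z) (-(ε * κ * Z z s⁻¹) - G (Z z) s⁻¹) s⁻¹ := by
      refine ((hexp.sub ((hTd (G (Z z)) s⁻¹).const_mul ε)).congr_of_eventuallyEq
        hloc).congr_deriv ?_
      rw [hZτ z s⁻¹, max_eq_right hτ.le]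
      have hz' : ε * z = z := by rcases hεz with h | h <;> simp [h]
      linear_combination κ * Real.exp (-κ * (s⁻¹ - τ₀)) * hz'
        + (-(G (Z z) s⁻¹)) * hε2
    have hd := (hdZ.comp s (hasDerivAt_inv hs0.ne')).const_add (ε * B)
    refine hd.congr_deriv ?_
    have hGv : G (Z z) s⁻¹ = H (Z z) s⁻¹ / σ := rfl
    rw [hGv]
    simp only [hH, max_eq_right hτ.le, inv_inv, truncate_of_abs_le (hZb z hz _), hN]
    field_simp
    ring
  · have h1 := ((continuous_profileOf (γ := γ) (σ := σ) (e := ε * B) hη.le (Z z)).tendsto 0)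
    have h2 : profileOf γ σ (ε * B) η (Z z) 0 = γ := by simp [profileOf]
    rw [h2] at h1
    exact h1.mono_left nhdsWithin_le_nhds
  · intro s hs
    rw [add_sub_cancel_left]
    exact (hZb z hz _).trans hηB
  · intro z z' hz hz' _ _ heq
    have h1 : ∀ τ, τ₀ < τ → Z z τ = Z z' τ := by
      intro τ hτ
      have hτ0 : 0 < τ := hτ₀0.trans hτ
      have h2 := heq (x := τ⁻¹) ⟨inv_pos.mpr hτ0, inv_lt_of_inv_lt₀ hS hτ⟩
      simpa using h2
    have h3 : Z z τ₀ = Z z' τ₀ := by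
      have hc1 : Tendsto (Z z) (𝓝[>] τ₀) (𝓝 (Z z τ₀)) :=
        ((Z z).continuous.tendsto τ₀).mono_left nhdsWithin_le_nhds
      have hc2 : Tendsto (Z z') (𝓝[>] τ₀) (𝓝 (Z z' τ₀)) :=
        ((Z z').continuous.tendsto τ₀).mono_left nhdsWithin_le_nhds
      refine tendsto_nhds_unique hc1 (hc2.congr' ?_)
      filter_upwards [self_mem_nhdsWithin] with τ hτ using (h1 τ hτ).symm
    have h4 : Z z = Z z' := by
      ext τ
      rcases le_or_gt τ τ₀ with hle | hgt
      · have h5 : ∀ w, Z w τ = Z w τ₀ := fun w => by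
          rw [hZτ w τ, hZτ w τ₀, max_eq_left hle, max_self]
        rw [h5, h5, h3]
      · exact h1 τ hgt
    have h6 := hZτ z τ₀
    have h7 := hZτ z' τ₀
    rw [h4] at h6
    simp only [max_self, sub_self, mul_zero, Real.exp_zero, mul_one] at h6 h7
    linarith

/-! ### Back to the original variables -/

theorem sigma_facts {θ m q : ℝ} (hm : 0 < m) (hκ : 0 < kappa m q) (hΘ : Theta θ m q < 0) :
    0 < sigma θ m q ∧ θ + 2 - m = -(m * sigma θ m q) := by
  constructor
  · exact div_pos (neg_pos.mpr (mul_neg_of_pos_of_neg hκ hΘ)) hm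
  · have := hκ.ne'
    rw [sigma, Theta]
    field_simp

/-- The limit `λ^(1/m) γ^((1-q)/m)` of `|σ v'|`, in terms of the coefficients of the profiles. -/
theorem exists_limit_slope {lam θ m q γ : ℝ} (hm : 0 < m) (hlam : 0 < lam) (hγ : 0 < γ)
    (hσ : 0 < sigma θ m q) :
    ∃ B > 0, B = lam ^ (1 / m) * γ ^ ((1 - q) / m) ∧ γ ^ q * B ^ m = lam * γ ∧
      a1 lam θ m q γ = B / (sigma θ m q * γ) ∧
      lam ^ (1 / m) / (sigma θ m q * γ ^ (kappa m q / m - 1)) = B / sigma θ m q := by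
  have hpow : γ ^ (kappa m q / m - 1) * γ ^ ((1 - q) / m) = 1 := by
    rw [← Real.rpow_add hγ]
    convert Real.rpow_zero γ using 2
    rw [kappa]
    field_simp
    ring
  have hpow' : γ ^ (kappa m q / m) = γ * γ ^ (kappa m q / m - 1) := by
    rw [mul_comm, ← Real.rpow_add_one hγ.ne', sub_add_cancel]
  have h1 : 0 < γ ^ (kappa m q / m - 1) := Real.rpow_pos_of_pos hγ _
  have h2 : 0 < γ ^ ((1 - q) / m) := Real.rpow_pos_of_pos hγ _
  have h3 : γ ^ ((1 - q) / m) = (γ ^ (kappa m q / m - 1))⁻¹ :=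
    eq_inv_of_mul_eq_one_right hpow
  refine ⟨lam ^ (1 / m) * γ ^ ((1 - q) / m), by positivity, rfl, ?_, ?_, ?_⟩
  · rw [Real.mul_rpow (by positivity) h2.le, ← Real.rpow_mul hlam.le, ← Real.rpow_mul hγ.le,
      div_mul_cancel₀ _ hm.ne', div_mul_cancel₀ _ hm.ne', Real.rpow_one, mul_left_comm,
      ← Real.rpow_add hγ, add_sub_cancel, Real.rpow_one]
  · rw [a1, hpow', h3]
    field_simp
  · rw [h3]
    field_simp

theorem tendsto_norm_rpow_nhdsGT {N : ℕ} {σ : ℝ} (hσ : 0 < σ) :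
    Tendsto (fun x : EuclideanSpace ℝ (Fin N) => ‖x‖ ^ σ) (𝓝[≠] 0) (𝓝[>] 0) := by
  rw [tendsto_nhdsWithin_iff]
  constructor
  · have h1 : Tendsto (fun x : EuclideanSpace ℝ (Fin N) => ‖x‖ ^ σ) (𝓝 0) (𝓝 (0 ^ σ)) := by
      have h2 := (continuous_norm (E := EuclideanSpace ℝ (Fin N))).tendsto 0
      rw [norm_zero] at h2
      exact h2.rpow_const (Or.inr hσ.le)
    rw [Real.zero_rpow hσ.ne'] at h1
    exact h1.mono_left nhdsWithin_le_nhds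
  · filter_upwards [self_mem_nhdsWithin] with x hx
    exact Real.rpow_pos_of_pos (norm_pos_iff.mpr hx) σ

theorem eventually_mem_puncturedBall (N : ℕ) {R : ℝ} (hR : 0 < R) :
    ∀ᶠ x in 𝓝[≠] (0 : EuclideanSpace ℝ (Fin N)), x ∈ puncturedBall N R := by
  filter_upwards [self_mem_nhdsWithin, nhdsWithin_le_nhds (Metric.ball_mem_nhds 0 hR)] with x h1 h2
  exact ⟨h2, h1⟩

theorem rpow_norm_pow {N : ℕ} (x : EuclideanSpace ℝ (Fin N)) (σ : ℝ) (k : ℕ) :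
    (‖x‖ ^ σ) ^ k = ‖x‖ ^ ((k : ℝ) * σ) := by
  rw [← Real.rpow_natCast, ← Real.rpow_mul (norm_nonneg x), mul_comm]

/-- The slope determines the profile. -/
theorem hasProfileP_of_tendsto_slope {N : ℕ} {β lam θ m q γ R B ε : ℝ}
    {u : EuclideanSpace ℝ (Fin N) → ℝ} {v p : ℝ → ℝ} (hσ : 0 < sigma θ m q) (hR : 0 < R)
    (hv : IsReducedSolution (sigma θ m q) β lam m q (R ^ sigma θ m q) v p)
    (huv : ∀ x ∈ puncturedBall N R, u x = v (‖x‖ ^ sigma θ m q))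
    (hBc : lam ^ (1 / m) / (sigma θ m q * γ ^ (kappa m q / m - 1)) = B / sigma θ m q)
    (hl : Tendsto v (𝓝[>] 0) (𝓝 γ)) (hp : Tendsto p (𝓝[>] 0) (𝓝 (ε * B))) :
    HasProfileP lam θ m q γ ε u := by
  set σ := sigma θ m q with hσ_def
  have hid : Tendsto (fun s : ℝ => s) (𝓝[>] 0) (𝓝 0) := tendsto_id.mono_left nhdsWithin_le_nhds
  have h1 : (fun s => v s - (γ + ε * (B / σ) * s)) =o[𝓝[>] 0] fun s => s ^ (0 + 1) := by
    refine isLittleO_pow_succ_of_deriv (f' := fun s => p s / σ - ε * (B / σ) * 1) ?_ ?_ ?_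
    · filter_upwards [hv.eventually (Real.rpow_pos_of_pos hR _)] with s hs
      refine (hs.2.2.1.sub (((hasDerivAt_id s).const_mul _).const_add γ))
    · simpa using hl.sub ((hid.const_mul (ε * (B / σ))).const_add γ)
    · simp only [pow_zero]
      rw [Asymptotics.isLittleO_one_iff]
      have := (hp.div_const σ).sub_const (ε * (B / σ) * 1)
      convert this using 2
      ring
  have h2 := h1.comp_tendsto (tendsto_norm_rpow_nhdsGT (N := N) hσ)
  rw [HasProfileP, hBc]
  refine h2.congr' ?_ ?_
  · filter_upwards [eventually_mem_puncturedBall N hR] with x hx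
    rw [huv x hx]
    rfl
  · refine Eventually.of_forall fun x => ?_
    change (‖x‖ ^ σ) ^ (0 + 1) = ‖x‖ ^ σ
    rw [zero_add, pow_one]

/-- `(P₊)` and `(P₋)` exclude each other. -/
theorem HasProfileP.eq {N : ℕ} (hN : 2 ≤ N) {lam θ m q γ ε ε' : ℝ} (hlam : 0 < lam) (hγ : 0 < γ)
    (hσ : 0 < sigma θ m q) {u : EuclideanSpace ℝ (Fin N) → ℝ}
    (h : HasProfileP lam θ m q γ ε u) (h' : HasProfileP lam θ m q γ ε' u) : ε = ε' := by
  have : NeZero N := ⟨by omega⟩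
  set c := lam ^ (1 / m) / (sigma θ m q * γ ^ (kappa m q / m - 1)) with hc
  have hc0 : 0 < c := by positivity
  have h1 : (fun x : EuclideanSpace ℝ (Fin N) => (ε' - ε) * c * ‖x‖ ^ sigma θ m q)
      =o[𝓝[≠] 0] fun x => ‖x‖ ^ sigma θ m q := by
    refine (Asymptotics.IsLittleO.sub h h').congr_left fun x => ?_
    rw [← hc]
    ring
  by_contra hne
  have hne' : (ε' - ε) * c ≠ 0 := mul_ne_zero (sub_ne_zero.mpr (Ne.symm hne)) hc0.ne'
  have h2 : (fun x : EuclideanSpace ℝ (Fin N) => ‖x‖ ^ sigma θ m q)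
      =o[𝓝[≠] 0] fun x => ‖x‖ ^ sigma θ m q :=
    (Asymptotics.isLittleO_const_mul_left_iff hne').mp h1
  have h3 := (Asymptotics.isLittleO_irrefl' (l := 𝓝[≠] (0 : EuclideanSpace ℝ (Fin N)))
    (f' := fun x => ‖x‖ ^ sigma θ m q) ?_) h2
  · exact h3
  · refine Eventually.frequently ?_
    filter_upwards [self_mem_nhdsWithin] with x hx
    exact norm_ne_zero_iff.mpr (Real.rpow_pos_of_pos (norm_pos_iff.mpr hx) _).ne'

theorem b1_sq_add_b2_sq_eq_zero_iff {ρ lam θ m q γ : ℝ} (hm : 0 < m) (hlam : 0 < lam)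
    (ha : 0 < a1 lam θ m q γ) :
    b1 ρ lam θ m q γ ^ 2 + b2 ρ lam θ m q γ ^ 2 = 0 ↔
      d1 ρ lam θ m q = 0 ∧ q * (1 - q) = 0 := by
  have hsplit : b1 ρ lam θ m q γ ^ 2 + b2 ρ lam θ m q γ ^ 2 = 0 ↔
      b1 ρ lam θ m q γ = 0 ∧ b2 ρ lam θ m q γ = 0 := by
    rw [add_eq_zero_iff_of_nonneg (sq_nonneg _) (sq_nonneg _), sq_eq_zero_iff, sq_eq_zero_iff]
  have h1 : b1 ρ lam θ m q γ = 0 ↔ d1 ρ lam θ m q = 0 := by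
    rw [b1, mul_eq_zero, div_eq_zero_iff]
    have h2 : a1 lam θ m q γ ^ 2 ≠ 0 := by positivity
    have h3 : 2 * lam * m ≠ 0 := by positivity
    simp [h2, h3]
  rw [hsplit, h1]
  refine and_congr_right fun hd => ?_
  have h2 : a1 lam θ m q γ ^ 3 ≠ 0 := by positivity
  have h3 : 6 * lam ^ 2 * m ^ 2 ≠ 0 := by positivity
  have h4 : lam ^ 2 * m ≠ 0 := by positivity
  rw [b2, hd, zero_mul, zero_add, mul_eq_zero, div_eq_zero_iff, mul_assoc (lam ^ 2 * m) q,
    mul_eq_zero]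
  tauto

theorem expCorrOne_eq_expScale {lam θ m γ B r : ℝ} (hlam : 0 < lam) (hr : 0 < r)
    (hσ : 0 < sigma θ m 1) (hm : 0 < m) (hB : B = lam ^ (1 / m)) :
    expCorrOne lam θ m 1 γ r =
      expScale (m * γ ^ (1 : ℝ) * B ^ (m - 1) / sigma θ m 1)
        (1 * m * B ^ m / sigma θ m 1 ^ 2 + 2) (r ^ sigma θ m 1) := by
  have hBm : B ^ m = lam := by
    rw [hB, ← Real.rpow_mul hlam.le, one_div_mul_cancel hm.ne', Real.rpow_one]
  have hBm1 : B ^ (m - 1) = lam ^ (1 - 1 / m) := by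
    rw [hB, ← Real.rpow_mul hlam.le]
    congr 1
    field_simp
  rw [expCorrOne, expScale, hBm, hBm1, ← Real.rpow_mul hr.le, Real.rpow_neg hr.le, Real.rpow_one]
  congr 2
  · field_simp
    ring
  · ring

theorem expCorrZero_eq_expScale {ρ lam θ m γ B r : ℝ} (hlam : 0 < lam) (hγ : 0 < γ) (hr : 0 < r)
    (hσ : 0 < sigma θ m 0) (hm : 0 < m) (hB : B = (lam * γ) ^ (1 / m)) :
    expCorrZero ρ lam θ m 0 γ r =
      expScale (m * γ ^ (0 : ℝ) * B ^ (m - 1) / sigma θ m 0)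
        (-((sigma θ m 0 - 2 * ρ) / sigma θ m 0) + 2) (r ^ sigma θ m 0) := by
  have hBm1 : B ^ (m - 1) = (lam * γ) ^ ((m - 1) / m) := by
    rw [hB, ← Real.rpow_mul (by positivity)]
    congr 1
    field_simp
  rw [expCorrZero, expScale, hBm1, ← Real.rpow_mul hr.le, Real.rpow_neg hr.le, Real.rpow_zero]
  congr 2
  · field_simp
    ring
  · ring

/-- A limit of the quotient by a positive scale, as an expansion on the punctured space. -/
theorem isLittleO_of_tendsto_div_scale {N : ℕ} {σ R C : ℝ} (hσ : 0 < σ) (hR : 0 < R)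
    {u e : EuclideanSpace ℝ (Fin N) → ℝ} {v f E : ℝ → ℝ}
    (huv : ∀ x ∈ puncturedBall N R, u x = v (‖x‖ ^ σ))
    (he : ∀ x, 0 < ‖x‖ → e x = E (‖x‖ ^ σ)) (hE : ∀ s, 0 < s → E s ≠ 0)
    (h : Tendsto (fun s => (v s - f s) / E s) (𝓝[>] 0) (𝓝 C)) :
    (fun x => u x - (f (‖x‖ ^ σ) + C * e x)) =o[𝓝[≠] 0] e := by
  have h1 : (fun s => v s - (f s + C * E s)) =o[𝓝[>] 0] E := by
    rw [Asymptotics.isLittleO_iff_tendsto' (by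
      filter_upwards [self_mem_nhdsWithin] with s hs h0 using absurd h0 (hE s hs))]
    have h2 := h.sub_const C
    rw [sub_self] at h2
    refine h2.congr' ?_
    filter_upwards [self_mem_nhdsWithin] with s hs
    have := hE s hs
    field_simp
    ring
  refine (h1.comp_tendsto (tendsto_norm_rpow_nhdsGT (N := N) hσ)).congr' ?_ ?_
  · filter_upwards [eventually_mem_puncturedBall N hR] with x hx
    rw [huv x hx, he x (mem_puncturedBall.mp hx).1]
    rfl
  · filter_upwards [self_mem_nhdsWithin] with x hx
    rw [he x (norm_pos_iff.mpr hx)]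
    rfl

/-- Behaviour of a positive radial solution with limit `γ`, once the sign of its slope is
known. -/
theorem IsReducedSolution.asymptotics {N : ℕ} {ρ lam θ m q γ R B ε : ℝ}
    {u : EuclideanSpace ℝ (Fin N) → ℝ} {v p : ℝ → ℝ} (hσ : 0 < sigma θ m q) (hR : 0 < R)
    (hm : 0 < m) (hlam : 0 < lam) (hγ : 0 < γ) (hB : 0 < B) (hε : ε = 1 ∨ ε = -1)
    (hBm : γ ^ q * B ^ m = lam * γ) (hBdef : B = lam ^ (1 / m) * γ ^ ((1 - q) / m))
    (hBa : a1 lam θ m q γ = B / (sigma θ m q * γ))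
    (hv : IsReducedSolution (sigma θ m q) (sigma θ m q - 2 * ρ) lam m q (R ^ sigma θ m q) v p)
    (huv : ∀ x ∈ puncturedBall N R, u x = v (‖x‖ ^ sigma θ m q))
    (hl : Tendsto v (𝓝[>] 0) (𝓝 γ)) (hp : Tendsto p (𝓝[>] 0) (𝓝 (ε * B))) :
    HasFourTermExpansion ρ lam θ m q γ ε u ∧
    (d1 ρ lam θ m q = 0 → q * (1 - q) = 0 → IsExactTwoTerm lam θ m q γ ε u ∨
      (ε = 1 ∧ ∃ C : ℝ, C ≠ 0 ∧
        ((q = 1 ∧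
          (fun x => u x - (γ + lam ^ (1 / m) / sigma θ m q * ‖x‖ ^ sigma θ m q
              + C * expCorrOne lam θ m q γ ‖x‖))
            =o[𝓝[≠] 0] (fun x => expCorrOne lam θ m q γ ‖x‖)) ∨
        (q = 0 ∧
          (fun x => u x - (γ + (lam * γ) ^ (1 / m) / sigma θ m q * ‖x‖ ^ sigma θ m q
              + C * expCorrZero ρ lam θ m q γ ‖x‖))
            =o[𝓝[≠] 0] (fun x => expCorrZero ρ lam θ m q γ ‖x‖))))) := by
  have hS : 0 < R ^ sigma θ m q := Real.rpow_pos_of_pos hR _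
  have hexp := hv.expansion (a := a1 lam θ m q γ) (β₁ := b1 ρ lam θ m q γ)
    (β₂ := b2 ρ lam θ m q γ) (D₁ := d1 ρ lam θ m q) (D₂ := d2 ρ lam θ m q) hS hσ hm hlam hγ hB hε
    hBm hBa rfl (by rw [d2]; ring) rfl rfl hl hp
  obtain ⟨hv3, hp2⟩ := hexp
  constructor
  · rw [HasFourTermExpansion]
    refine (hv3.comp_tendsto (tendsto_norm_rpow_nhdsGT (N := N) hσ)).congr' ?_ ?_
    · filter_upwards [eventually_mem_puncturedBall N hR] with x hx
      simp only [Function.comp, rpow_norm_pow, huv x hx]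
      norm_num
    · exact Eventually.of_forall fun x => by simp [Function.comp, rpow_norm_pow]
  · intro hd1 hq01
    have hq' : q = 0 ∨ q = 1 := by
      rcases mul_eq_zero.mp hq01 with h | h
      · exact Or.inl h
      · exact Or.inr (by linarith)
    have hb1 : b1 ρ lam θ m q γ = 0 := by
      rw [b1, hd1]
      simp
    have hb2 : b2 ρ lam θ m q γ = 0 := by
      rw [b2, hd1, mul_assoc (lam ^ 2 * m) q, hq01]
      simp
    rw [hb1, hb2, hBa] at hv3
    rw [hb1, hb2, hBa] at hp2
    have hv3' : (fun s => v s - (γ + ε * B / sigma θ m q * s)) =o[𝓝[>] 0] fun s => s ^ 3 := by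
      refine hv3.congr_left fun s => ?_
      field_simp
      ring
    have hp2' : (fun s => p s - ε * B) =o[𝓝[>] 0] fun s => s ^ 2 := by
      refine hp2.congr_left fun s => ?_
      field_simp
      ring
    rcases hv.affine_or_exponential hS hσ hm hγ hB hε hBm hq' hd1 hl hp hv3' hp2' with
      haff | ⟨rfl, C, hC, hlim⟩
    · left
      filter_upwards [(tendsto_norm_rpow_nhdsGT (N := N) hσ).eventually haff,
        eventually_mem_puncturedBall N hR] with x h1 hx
      rw [huv x hx, h1, hBa]
      field_simp
    · refine Or.inr ⟨rfl, C, hC, ?_⟩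
      simp only [one_mul] at hlim
      rcases hq' with rfl | rfl
      · right
        have hBz : B = (lam * γ) ^ (1 / m) := by
          rw [hBdef, Real.mul_rpow hlam.le hγ.le, sub_zero]
        refine ⟨rfl, ?_⟩
        have := isLittleO_of_tendsto_div_scale hσ hR (u := u) (v := v)
          (f := fun s => γ + B / sigma θ m 0 * s) (e := fun x => expCorrZero ρ lam θ m 0 γ ‖x‖)
          huv (fun x hx => expCorrZero_eq_expScale hlam hγ hx hσ hm hBz)
          (fun s hs => (expScale_pos hs).ne') (by simpa using hlim)
        simpa only [← hBz] using this
      · left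
        have hB1 : B = lam ^ (1 / m) := by
          rw [hBdef]
          simp
        have hβ0 : sigma θ m 1 - 2 * ρ = 0 := by
          rw [d1, sub_self, mul_zero, add_zero] at hd1
          exact (mul_eq_zero.mp hd1).resolve_left hσ.ne'
        rw [hβ0, zero_div, sub_zero] at hlim
        refine ⟨rfl, ?_⟩
        have := isLittleO_of_tendsto_div_scale hσ hR (u := u) (v := v)
          (f := fun s => γ + B / sigma θ m 1 * s) (e := fun x => expCorrOne lam θ m 1 γ ‖x‖)
          huv (fun x hx => expCorrOne_eq_expScale hlam hx hσ hm hB1)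
          (fun s hs => (expScale_pos hs).ne') hlim
        simpa only [← hB1] using this

/-- A solution of the reduced system with slope close to `ε B` yields a positive radial solution
with the profile of sign `ε`. -/
theorem IsReducedSolution.radial_solution_hasProfileP (N : ℕ) {ρ lam θ m q γ R B ε : ℝ}
    {v p : ℝ → ℝ} (hσ : 0 < sigma θ m q) (hσm : θ + 2 - m = -(m * sigma θ m q)) (hR : 0 < R)
    (hm : 0 < m) (hγ : 0 < γ) (hB : 0 < B) (hε : ε = 1 ∨ ε = -1)
    (hBm : γ ^ q * B ^ m = lam * γ)
    (hBc : lam ^ (1 / m) / (sigma θ m q * γ ^ (kappa m q / m - 1)) = B / sigma θ m q)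
    (hv : IsReducedSolution (sigma θ m q) (sigma θ m q - 2 * ρ) lam m q (R ^ sigma θ m q) v p)
    (hl : Tendsto v (𝓝[>] 0) (𝓝 γ))
    (hp : ∀ s ∈ Ioo 0 (R ^ sigma θ m q), |p s - ε * B| ≤ B / 2) :
    IsPosRadialSolution ρ lam θ m q R
        (fun x : EuclideanSpace ℝ (Fin N) => v (‖x‖ ^ sigma θ m q)) ∧
      HasProfileP lam θ m q γ ε
        (fun x : EuclideanSpace ℝ (Fin N) => v (‖x‖ ^ sigma θ m q)) := by
  have hS : 0 < R ^ sigma θ m q := Real.rpow_pos_of_pos hR _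
  refine ⟨hv.isPosRadialSolution N hσ hσm fun s hs h0 => ?_,
    hasProfileP_of_tendsto_slope hσ hR hv (fun x _ => rfl) hBc hl ?_⟩
  · have h1 := abs_le.mp (hp s hs)
    rw [h0] at h1
    rcases hε with rfl | rfl <;> linarith [h1.1, h1.2]
  · have hev : ∀ᶠ s in 𝓝[>] 0, |p s - ε * B| ≤ B / 2 := by
      filter_upwards [Ioo_mem_nhdsGT hS] with s hs using hp s hs
    have hlim : ∀ l, Tendsto p (𝓝[>] 0) (𝓝 l) → |l - ε * B| ≤ B / 2 := fun l h =>
      le_of_tendsto (h.sub_const (ε * B)).abs hev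
    rcases hv.tendsto_slope hS hσ hm hγ hB hBm hl with h | h
    · have h1 := abs_le.mp (hlim _ h)
      rcases hε with rfl | rfl
      · simpa using h
      · linarith [h1.2]
    · have h1 := abs_le.mp (hlim _ h)
      rcases hε with rfl | rfl
      · linarith [h1.1]
      · simpa using h

end HardyGrad

theorem theorem1p1 (N : ℕ) (hN : 2 ≤ N) (ρ lam θ m q : ℝ)
    (hm : 0 < m) (hq : 0 ≤ q) (hκ : 0 < kappa m q)
    (hΘ : Theta θ m q < 0) (hlam : 0 < lam) :
    -- (I)
    (∀ (γ R : ℝ) (u : EuclideanSpace ℝ (Fin N) → ℝ), 0 < γ → 0 < R →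
      IsPosRadialSolution ρ lam θ m q R u →
      Filter.Tendsto u (nhdsWithin 0 {0}ᶜ) (nhds γ) →
      (HasProfileP lam θ m q γ 1 u ∨ HasProfileP lam θ m q γ (-1) u) ∧
      -- (a)
      (b1 ρ lam θ m q γ ^ 2 + b2 ρ lam θ m q γ ^ 2 ≠ 0 →
        (HasProfileP lam θ m q γ 1 u → HasFourTermExpansion ρ lam θ m q γ 1 u) ∧
        (HasProfileP lam θ m q γ (-1) u → HasFourTermExpansion ρ lam θ m q γ (-1) u)) ∧
      -- (b)
      (b1 ρ lam θ m q γ ^ 2 + b2 ρ lam θ m q γ ^ 2 = 0 ↔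
        d1 ρ lam θ m q = 0 ∧ q * (1 - q) = 0) ∧
      (b1 ρ lam θ m q γ ^ 2 + b2 ρ lam θ m q γ ^ 2 = 0 →
        (HasProfileP lam θ m q γ 1 u →
          IsExactTwoTerm lam θ m q γ 1 u ∨
          ∃ C : ℝ, C ≠ 0 ∧
            ((q = 1 ∧
              (fun x => u x - (γ + lam ^ (1 / m) / sigma θ m q * ‖x‖ ^ sigma θ m q
                  + C * expCorrOne lam θ m q γ ‖x‖))
                =o[nhdsWithin 0 {0}ᶜ] (fun x => expCorrOne lam θ m q γ ‖x‖)) ∨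
            (q = 0 ∧
              (fun x => u x - (γ + (lam * γ) ^ (1 / m) / sigma θ m q * ‖x‖ ^ sigma θ m q
                  + C * expCorrZero ρ lam θ m q γ ‖x‖))
                =o[nhdsWithin 0 {0}ᶜ] (fun x => expCorrZero ρ lam θ m q γ ‖x‖)))) ∧
        (HasProfileP lam θ m q γ (-1) u → IsExactTwoTerm lam θ m q γ (-1) u))) ∧
    -- (II)
    (∀ γ : ℝ, 0 < γ → ∃ R : ℝ, 0 < R ∧
      (∃ u : EuclideanSpace ℝ (Fin N) → ℝ,
        IsPosRadialSolution ρ lam θ m q R u ∧ HasProfileP lam θ m q γ (-1) u) ∧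
      -- infinitely many, counted as functions on the punctured ball
      Set.Infinite ((fun u : EuclideanSpace ℝ (Fin N) → ℝ => (puncturedBall N R).domRestrict u) ''
        {u | IsPosRadialSolution ρ lam θ m q R u ∧ HasProfileP lam θ m q γ 1 u})) := by
  obtain ⟨hσ, hσm⟩ := sigma_facts hm hκ hΘ
  constructor
  · intro γ R u hγ hR hu hlim
    obtain ⟨B, hB, hBdef, hBm, hBa, hBc⟩ := exists_limit_slope (q := q) (θ := θ) hm hlam hγ hσ
    obtain ⟨v, p, hv, huv, hvl⟩ := hu.exists_reduced hN hσ hσm hR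
    have hl := hvl γ hlim
    have hS : 0 < R ^ sigma θ m q := Real.rpow_pos_of_pos hR _
    have hslope := hv.tendsto_slope hS hσ hm hγ hB hBm hl
    have hprof : ∀ ε : ℝ, Filter.Tendsto p (nhdsWithin 0 (Set.Ioi 0)) (nhds (ε * B)) →
        HasProfileP lam θ m q γ ε u := fun ε hp =>
      hasProfileP_of_tendsto_slope hσ hR hv huv hBc hl hp
    -- the slope of a solution with a given profile, since only `±B` are possible
    have hback : ∀ ε : ℝ, HasProfileP lam θ m q γ ε u →
        Filter.Tendsto p (nhdsWithin 0 (Set.Ioi 0)) (nhds (ε * B)) := by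
      intro ε hP
      rcases hslope with h | h
      · have h1 : Filter.Tendsto p (nhdsWithin 0 (Set.Ioi 0)) (nhds (1 * B)) := by simpa using h
        rwa [hP.eq hN hlam hγ hσ (hprof 1 h1)]
      · have h1 : Filter.Tendsto p (nhdsWithin 0 (Set.Ioi 0)) (nhds (-1 * B)) := by
          simpa using h
        rwa [hP.eq hN hlam hγ hσ (hprof (-1) h1)]
    have hasy := fun (ε : ℝ) (hε : ε = 1 ∨ ε = -1) (hP : HasProfileP lam θ m q γ ε u) =>
      hv.asymptotics hσ hR hm hlam hγ hB hε hBm hBdef hBa huv hl (hback ε hP)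
    have hiff := b1_sq_add_b2_sq_eq_zero_iff (ρ := ρ) (θ := θ) (q := q) (γ := γ) hm hlam
      (by rw [hBa]; positivity)
    refine ⟨?_, fun _ => ⟨fun hP => (hasy 1 (Or.inl rfl) hP).1,
      fun hP => (hasy (-1) (Or.inr rfl) hP).1⟩, hiff, fun hb => ?_⟩
    · rcases hslope with h | h
      · exact Or.inl (hprof 1 (by simpa using h))
      · exact Or.inr (hprof (-1) (by simpa using h))
    · obtain ⟨hd, hq01⟩ := hiff.mp hb
      refine ⟨fun hP => ((hasy 1 (Or.inl rfl) hP).2 hd hq01).imp id fun h => h.2, fun hP => ?_⟩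
      rcases (hasy (-1) (Or.inr rfl) hP).2 hd hq01 with h | h
      · exact h
      · exact absurd h.1 (by norm_num)
  · intro γ hγ
    have : NeZero N := ⟨by omega⟩
    obtain ⟨B, hB, hBdef, hBm, hBa, hBc⟩ := exists_limit_slope (q := q) (θ := θ) hm hlam hγ hσ
    obtain ⟨S₁, hS₁, η₁, hη₁, H₁⟩ := exists_reduced_solutions (β := sigma θ m q - 2 * ρ)
      (ε := 1) hσ hm hq hγ hB hBm (Or.inl rfl)
    obtain ⟨S₂, hS₂, η₂, hη₂, H₂⟩ := exists_reduced_solutions (β := sigma θ m q - 2 * ρ)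
      (ε := -1) hσ hm hq hγ hB hBm (Or.inr rfl)
    have hS : 0 < min S₁ S₂ := lt_min hS₁ hS₂
    set R := min S₁ S₂ ^ (sigma θ m q)⁻¹ with hR_def
    have hR : 0 < R := Real.rpow_pos_of_pos hS _
    have hRS : R ^ sigma θ m q = min S₁ S₂ := Real.rpow_inv_rpow hS.le hσ.ne'
    refine ⟨R, hR, ?_, ?_⟩
    · obtain ⟨v, p, hvp, -⟩ := H₂ _ hS (min_le_right _ _)
      obtain ⟨hv, hl, hp⟩ := hvp 0 (by simpa using hη₂.le) (Or.inr rfl)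
      rw [← hRS] at hv hp
      exact ⟨_, hv.radial_solution_hasProfileP N hσ hσm hR hm hγ hB (Or.inr rfl) hBm hBc hl hp⟩
    · obtain ⟨v, p, hvp, hinj⟩ := H₁ _ hS (min_le_left _ _)
      rw [← hRS] at hvp hinj
      set z : ℕ → ℝ := fun n => η₁ / (n + 1) with hz
      have hzb : ∀ n, |z n| ≤ η₁ := by
        intro n
        rw [abs_of_pos (by positivity)]
        exact div_le_self hη₁.le (by linarith [Nat.cast_nonneg (α := ℝ) n])
      refine Set.infinite_of_injective_forall_mem (f := fun n : ℕ =>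
        (puncturedBall N R).domRestrict
          (fun x : EuclideanSpace ℝ (Fin N) => v (z n) (‖x‖ ^ sigma θ m q))) ?_ ?_
      · intro i j hij
        have hveq : Set.EqOn (v (z i)) (v (z j)) (Set.Ioo 0 (R ^ sigma θ m q)) := by
          intro s hs
          obtain ⟨x, hx⟩ := exists_norm_eq (EuclideanSpace ℝ (Fin N))
            (Real.rpow_nonneg hs.1.le (sigma θ m q)⁻¹)
          have hxs : ‖x‖ ^ sigma θ m q = s := by
            rw [hx, Real.rpow_inv_rpow hs.1.le hσ.ne']
          have hxR : x ∈ puncturedBall N R := by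
            rw [mem_puncturedBall, hx]
            refine ⟨Real.rpow_pos_of_pos hs.1 _, ?_⟩
            have h1 := Real.rpow_lt_rpow hs.1.le hs.2 (inv_pos.mpr hσ)
            rwa [Real.rpow_rpow_inv hR.le hσ.ne'] at h1
          have := congrFun hij ⟨x, hxR⟩
          simpa only [Set.domRestrict_apply, hxs] using this
        have hpeq : Set.EqOn (p (z i)) (p (z j)) (Set.Ioo 0 (R ^ sigma θ m q)) := by
          intro s hs
          have h1 := (hvp (z i) (hzb i) (Or.inl rfl)).1.deriv_v s hs
          have h2 := (hvp (z j) (hzb j) (Or.inl rfl)).1.deriv_v s hs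
          have h3 := h1.unique (h2.congr_of_eventuallyEq
            (hveq.eventuallyEq_of_mem (isOpen_Ioo.mem_nhds hs)))
          exact (div_left_inj' hσ.ne').mp h3
        have h4 := hinj _ _ (hzb i) (hzb j) (Or.inl rfl) (Or.inl rfl) hpeq
        simp only [hz] at h4
        rw [div_eq_div_iff (by positivity) (by positivity)] at h4
        have h5 : (j : ℝ) + 1 = i + 1 := mul_left_cancel₀ hη₁.ne' h4
        have h6 : j + 1 = i + 1 := by exact_mod_cast h5
        omega
      · intro n
        obtain ⟨hv, hl, hp⟩ := hvp (z n) (hzb n) (Or.inl rfl)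
        exact ⟨_, hv.radial_solution_hasProfileP N hσ hσm hR hm hγ hB (Or.inl rfl) hBm hBc hl hp,
          rfl⟩
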